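/- All theories are first-order. A theory $T$ is *finite-dimensional* if there is a function $\dim$ from the class of all interpretable sets in models of $T$ (definable sets modulo definable equivalence relations, with parameters) to $\omega\cup\{-\infty\}$ such that, for every formula $\varphi(x,y)$ and all interpretable sets $X,Y$ and interpretable functions $f:X\to Y$ in a model of $T$: (1) if $a,a'$ have the same type over $\emptyset$, then $\dim\varphi(x,a)=\dim\varphi(x,a')$; (2) $\dim\emptyset=-\infty$, and $\dim X=0$ if and only if $X$ is finite and non-empty; (3) $\dim(X\cup Y)=\max\{\dim X,\dim Y\}$, for $X,Y$ subsets of the same ambient interpretable set; (4) for $k\in\omega$, if $\dim f^{-1}(y)\ge k$ for all $y\in Y$, then $\dim X\ge\dim Y+k$; (5) for $k\in\omega$, if $\dim f^{-1}(y)\le k$ for all $y\in Y$, then $\dim X\le\dim Y+k$. For a group $G$, the *almost centre* $\widetilde Z(G)$ is the subgroup of all $g\in G$ whose centraliser $C_G(g)$ has finite index in $G$. Put $\widetilde Z^0(G)=\{1\}$ and let $\widetilde Z^{n+1}(G)$ be the preimage in $G$ of $\widetilde Z(G/\widetilde Z^n(G))$; so $\widetilde Z^1(G)=\widetilde Z(G)$.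 The group $G$ is *almost nilpotent* if $\widetilde Z^n(G)=G$ for some $n$, *locally nilpotent* if all its finitely generated subgroups are nilpotent, and *virtually nilpotent* if it has a nilpotent subgroup of finite index. **Lemma.** Let $T$ be a finite-dimensional theory, let $M$ be a model of $T$, and let $G$ be a locally nilpotent group that is definable, or more generally interpretable, in $M$ with parameters. Then: 1. if $G$ is infinite, its almost centre $\widetilde Z(G)$ is infinite; 2. $G$ is almost nilpotent; 3. $G$ is virtually nilpotent. -/

import Mathlib

universe u v w x

namespace FinDim

section Interpretable

/-- An equivalence relation on `M ^ n` which is definable in `M` with parameters. An interpretable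
set in `M` is a definable set modulo such a relation. -/
structure DefSetoid (L : FirstOrder.Language.{u, v}) (M : Type w) [L.Structure M] (n : ℕ) where
  /-- the equivalence relation -/
  toSetoid : Setoid (Fin n → M)
  definable_rel : (Set.univ : Set M).Definable L
    {p : Fin n ⊕ Fin n → M | toSetoid.r (fun i => p (Sum.inl i)) (fun i => p (Sum.inr i))}

variable {L : FirstOrder.Language.{u, v}} {M : Type w} [L.Structure M] {n k : ℕ}

/-- The quotient of `M ^ n` by a definable equivalence relation. -/
abbrev DefSetoid.Points (E : DefSetoid L M n) : Type w := Quotient E.toSetoid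

/-- The class of an `n`-tuple. -/
abbrev DefSetoid.cls (E : DefSetoid L M n) (a : Fin n → M) : E.Points :=
  Quotient.mk E.toSetoid a

/-- A subset of `M ^ n / E` is interpretable if its preimage in `M ^ n` is definable in `M`, with
parameters. -/
def IsInterpretable (E : DefSetoid L M n) (X : Set E.Points) : Prop :=
  (Set.univ : Set M).Definable L {a : Fin n → M | E.cls a ∈ X}

/-- The map `f` restricts to an interpretable function from `X` to `Y`: it maps `X` into `Y` and the
graph of its restriction to `X` is interpretable. -/
def IsInterpretableMap (E : DefSetoid L M n) (F : DefSetoid L M k)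
    (X : Set E.Points) (Y : Set F.Points) (f : E.Points → F.Points) : Prop :=
  Set.MapsTo f X Y ∧ (Set.univ : Set M).Definable L
    {p : Fin n ⊕ Fin k → M | E.cls (fun i => p (Sum.inl i)) ∈ X ∧
      f (E.cls (fun i => p (Sum.inl i))) = F.cls (fun i => p (Sum.inr i))}

/-- The subset `X` of `M ^ n / E` is the interpretable set given by the parameter-free formulas
`φ(x, z)` (for the set) and `ε(x, x', z)` (for the equivalence relation) at the parameters `a`
in place of `z`. -/
def IsGivenBy (E : DefSetoid L M n) (X : Set E.Points) {m : ℕ}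
    (φ : L.Formula (Fin n ⊕ Fin m)) (ε : L.Formula ((Fin n ⊕ Fin n) ⊕ Fin m))
    (a : Fin m → M) : Prop :=
  (∀ b : Fin n → M, E.cls b ∈ X ↔ φ.Realize (Sum.elim b a)) ∧
  (∀ b c : Fin n → M, E.toSetoid.r b c ↔ ε.Realize (Sum.elim (Sum.elim b c) a))

end Interpretable

/-- The axioms of a dimension on the interpretable sets in the models of `T`, with values in
`ω ∪ {-∞}` (`⊥` is `-∞`). The values at sets that are not interpretable play no role. -/
structure IsDimension {L : FirstOrder.Language.{u, v}} (T : L.Theory)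
    (dim : ∀ (M : FirstOrder.Language.Theory.ModelType.{u, v, w} T) {n : ℕ}
      (E : DefSetoid L M n), Set E.Points → WithBot ℕ) : Prop where
  /-- Invariance: the dimension of the set given by a formula depends only on the type over the
  empty set of its parameters. -/
  invariance : ∀ (M N : FirstOrder.Language.Theory.ModelType.{u, v, w} T) {n m : ℕ}
    (φ : L.Formula (Fin n ⊕ Fin m)) (ε : L.Formula ((Fin n ⊕ Fin n) ⊕ Fin m))
    (a : Fin m → M) (a' : Fin m → N), T.typeOf a = T.typeOf a' →
    ∀ (E : DefSetoid L M n) (E' : DefSetoid L N n) (X : Set E.Points) (X' : Set E'.Points),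
      IsGivenBy E X φ ε a → IsGivenBy E' X' φ ε a' → dim M E X = dim N E' X'
  empty : ∀ (M : FirstOrder.Language.Theory.ModelType.{u, v, w} T) {n : ℕ}
    (E : DefSetoid L M n), dim M E ∅ = ⊥
  /-- The sets of dimension zero are the finite (non-empty) ones. -/
  zero_iff : ∀ (M : FirstOrder.Language.Theory.ModelType.{u, v, w} T) {n : ℕ}
    (E : DefSetoid L M n) (X : Set E.Points), IsInterpretable E X →
    (dim M E X = 0 ↔ X.Finite ∧ X.Nonempty)
  union : ∀ (M : FirstOrder.Language.Theory.ModelType.{u, v, w} T) {n : ℕ}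
    (E : DefSetoid L M n) (X Y : Set E.Points), IsInterpretable E X → IsInterpretable E Y →
    dim M E (X ∪ Y) = max (dim M E X) (dim M E Y)
  le_of_fibres : ∀ (M : FirstOrder.Language.Theory.ModelType.{u, v, w} T) {n k : ℕ}
    (E : DefSetoid L M n) (F : DefSetoid L M k) (X : Set E.Points) (Y : Set F.Points)
    (f : E.Points → F.Points) (d : ℕ), IsInterpretable E X → IsInterpretable F Y →
    IsInterpretableMap E F X Y f →
    (∀ y ∈ Y, (d : WithBot ℕ) ≤ dim M E {b | b ∈ X ∧ f b = y}) →
    dim M F Y + (d : WithBot ℕ) ≤ dim M E X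
  ge_of_fibres : ∀ (M : FirstOrder.Language.Theory.ModelType.{u, v, w} T) {n k : ℕ}
    (E : DefSetoid L M n) (F : DefSetoid L M k) (X : Set E.Points) (Y : Set F.Points)
    (f : E.Points → F.Points) (d : ℕ), IsInterpretable E X → IsInterpretable F Y →
    IsInterpretableMap E F X Y f →
    (∀ y ∈ Y, dim M E {b | b ∈ X ∧ f b = y} ≤ (d : WithBot ℕ)) →
    dim M E X ≤ dim M F Y + (d : WithBot ℕ)

/-- A theory is finite-dimensional if the interpretable sets in its models carry a dimension. -/
def IsFiniteDimensional {L : FirstOrder.Language.{u, v}} (T : L.Theory) : Prop :=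
  ∃ dim : ∀ (M : FirstOrder.Language.Theory.ModelType.{u, v, w} T) {n : ℕ}
    (E : DefSetoid L M n), Set E.Points → WithBot ℕ, IsDimension.{u, v, w} T dim

/-- The group `G` is definable in `M ^ eq`, with parameters: up to a bijection its underlying set is
an interpretable set `X ⊆ M ^ n / E` and the graph of its multiplication is interpretable. The
groups definable in `M` are those for which `E` can be taken to be equality. -/
def IsDefinableGroup (L : FirstOrder.Language.{u, v}) (M : Type w) [L.Structure M]
    (G : Type x) [Group G] : Prop :=
  ∃ (n : ℕ) (E : DefSetoid L M n) (X : Set E.Points) (e : G ≃ X),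
    IsInterpretable E X ∧ (Set.univ : Set M).Definable L
      {p : Fin 3 × Fin n → M | ∃ g h : G, E.cls (fun i => p (0, i)) = e g ∧
        E.cls (fun i => p (1, i)) = e h ∧ E.cls (fun i => p (2, i)) = e (g * h)}

section Groups

variable (G : Type x) [Group G]

/-- Every finitely generated subgroup is nilpotent. -/
def IsLocallyNilpotent : Prop := ∀ H : Subgroup G, H.FG → Group.IsNilpotent H

/-- The almost centre: the elements whose centraliser has finite index. -/
def almostCentre : Subgroup G where
  carrier := {g | (Subgroup.centralizer {g}).FiniteIndex}
  one_mem' := by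
    have h : Subgroup.centralizer ({1} : Set G) = ⊤ := by
      ext y; simp [Subgroup.mem_centralizer_singleton_iff]
    simp only [Set.mem_ofPred_eq, h]
    infer_instance
  mul_mem' {a b} ha hb := by
    have ha' : (Subgroup.centralizer ({a} : Set G)).FiniteIndex := ha
    have hb' : (Subgroup.centralizer ({b} : Set G)).FiniteIndex := hb
    refine Subgroup.finiteIndex_of_le
      (H := Subgroup.centralizer ({a} : Set G) ⊓ Subgroup.centralizer {b}) ?_
    rintro y ⟨hya, hyb⟩
    replace hya : y * a = a * y := Subgroup.mem_centralizer_singleton_iff.1 hya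
    replace hyb : y * b = b * y := Subgroup.mem_centralizer_singleton_iff.1 hyb
    rw [Subgroup.mem_centralizer_singleton_iff, ← mul_assoc, hya, mul_assoc, hyb, mul_assoc]
  inv_mem' {a} ha := by
    have ha' : (Subgroup.centralizer ({a} : Set G)).FiniteIndex := ha
    refine Subgroup.finiteIndex_of_le (H := Subgroup.centralizer ({a} : Set G)) ?_
    intro y hy
    rw [Subgroup.mem_centralizer_singleton_iff] at hy ⊢
    exact (Commute.inv_right (show Commute y a from hy)).eq

instance almostCentre_normal : (almostCentre G).Normal where
  conj_mem a ha g := by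
    have ha' : (Subgroup.centralizer ({a} : Set G)).FiniteIndex := ha
    have h : Subgroup.centralizer ({g * a * g⁻¹} : Set G) =
        (Subgroup.centralizer ({a} : Set G)).comap (MulAut.conj g⁻¹).toMonoidHom := by
      ext y
      simp only [Subgroup.mem_centralizer_singleton_iff, Subgroup.mem_comap,
        MulEquiv.coe_toMonoidHom, MulAut.conj_apply, inv_inv]
      constructor
      · intro hy
        calc g⁻¹ * y * g * a = g⁻¹ * (y * (g * a * g⁻¹)) * g := by group
          _ = a * (g⁻¹ * y * g) := by rw [hy]; group
      · intro hy
        calc y * (g * a * g⁻¹) = g * (g⁻¹ * y * g * a) * g⁻¹ := by group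
          _ = g * a * g⁻¹ * y := by rw [hy]; group
    change (Subgroup.centralizer ({g * a * g⁻¹} : Set G)).FiniteIndex
    refine ⟨?_⟩
    rw [h, Subgroup.index_comap_of_surjective _ (MulAut.conj g⁻¹).surjective]
    exact ha'.index_ne_zero

/-- The iterated almost centres as normal subgroups: the next one is the preimage in `G` of the
almost centre of the quotient of `G` by the present one. -/
def iteratedAlmostCentreAux : ℕ → {H : Subgroup G // H.Normal}
  | 0 => ⟨⊥, inferInstance⟩
  | n + 1 =>
    let N := iteratedAlmostCentreAux n
    have : N.1.Normal := N.2
    ⟨(almostCentre (G ⧸ N.1)).comap (QuotientGroup.mk' N.1), inferInstance⟩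

/-- The `n`-th almost centre, with the trivial subgroup as the zeroth one. -/
def iteratedAlmostCentre (n : ℕ) : Subgroup G := (iteratedAlmostCentreAux G n).1

/-- A group is almost nilpotent if it is equal to one of its iterated almost centres. -/
def IsAlmostNilpotent : Prop := ∃ n : ℕ, iteratedAlmostCentre G n = ⊤

end Groups

end FinDim

/-! Everything rests on a chain condition: some `k` bounds the length of chains of centralisers in
which every step has index at least `k` (`ChainBounded`). If it failed, an ultrapower of the group
would contain an infinite descending chain of centralisers, each of infinite index in the one
before. The ultrapower is interpretable in an ultrapower of `M`, again a model of `T`, and there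
every such step lowers the dimension by at least one, which is impossible (`chainBounded`).

The chain condition bounds the indices of the centralisers of elements of the almost centre, which
is therefore definable. If the almost centre `N` is finite, it also gives a finite set `F` with
finite centraliser, so only finitely many elements commute with `F` modulo `N`. Should `N` be
proper, add to `F` an element outside `N` and, for each of those finitely many elements lying
outside `N`, a witness that it is not central modulo `N`. The resulting finite set generates a
subgroup whose nilpotent image in `G ⧸ N` is nontrivial but has trivial centre, a contradiction. So
`G = N` is finite (`finite_of_finite_almostCentre`).

Hence an infinite `G` has an infinite almost centre, and dividing by it lowers the dimension;
induction on the dimension proves almost nilpotency. For virtual nilpotency the step back from the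
quotient is a theorem in the style of B. H. Neumann: with `H` the almost centre, some subgroup `K`
of finite index has only finitely many commutators with `H` (`finite_commutators`), and centralising
these makes `H` contribute only two further steps to the lower central series. -/

namespace FinDim

open Subgroup

/-! ### Chains of centralisers up to bounded index -/

section ChainCondition

variable {G : Type x} [Group G]

/-- The subgroup `H` meets at least `k` left cosets of the centraliser of `g`. -/
def HasOrbit (k : ℕ) (H : Subgroup G) (g : G) : Prop :=
  ∃ y : Fin k → G, (∀ a, y a ∈ H) ∧ ∀ a b, a ≠ b → (y a)⁻¹ * y b ∉ centralizer {g}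

/-- There is a chain of `r` centralisers below `H` in which each step has index at least `k`. -/
def HasChain (k : ℕ) : ℕ → Subgroup G → Prop
  | 0, _ => True
  | r + 1, H => ∃ g, HasOrbit k H g ∧ HasChain k r (H ⊓ centralizer {g})

variable (G) in
/-- The chain condition on centralisers up to bounded index. -/
def ChainBounded : Prop := ∃ k, ¬ HasChain k k (⊤ : Subgroup G)

/-- The value `relIndex = 0` stands for infinite index, where any number of distinct cosets is
available; hence the disjunction. -/
theorem hasOrbit_iff {k : ℕ} {H : Subgroup G} {g : G} :
    HasOrbit k H g ↔ (centralizer {g}).relIndex H = 0 ∨ k ≤ (centralizer {g}).relIndex H := by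
  constructor
  · rintro ⟨y, hy, hyy⟩
    by_cases h0 : (centralizer {g}).relIndex H = 0
    · exact Or.inl h0
    right
    have hfin : Finite (H ⧸ (centralizer {g}).subgroupOf H) :=
      Nat.finite_of_card_ne_zero h0
    have := Nat.card_le_card_of_injective
      (fun a => (QuotientGroup.mk ⟨y a, hy a⟩ : H ⧸ (centralizer {g}).subgroupOf H)) ?_
    · rwa [Nat.card_fin] at this
    · intro a b hab
      by_contra hne
      rw [QuotientGroup.eq] at hab
      exact hyy a b hne (by simpa [mem_subgroupOf] using hab)
  · intro h
    have : Nonempty (Fin k ↪ H ⧸ (centralizer {g}).subgroupOf H) := by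
      rcases finite_or_infinite (H ⧸ (centralizer {g}).subgroupOf H) with hf | hi
      · have := Fintype.ofFinite (H ⧸ (centralizer {g}).subgroupOf H)
        apply Function.Embedding.nonempty_of_card_le
        rw [Fintype.card_fin, ← Nat.card_eq_fintype_card]
        rcases h with h | h
        · exact absurd h Nat.card_pos.ne'
        · exact h
      · exact ⟨(Fin.valEmbedding).trans (Infinite.natEmbedding _)⟩
    obtain ⟨f⟩ := this
    refine ⟨fun a => ((f a).out : H), fun a => ((f a).out).2, fun a b hab hc => hab (f.injective ?_)⟩
    rw [← (f a).out_eq', ← (f b).out_eq']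
    exact QuotientGroup.eq.2 (by simpa [mem_subgroupOf] using hc)

theorem mem_almostCentre {g : G} : g ∈ almostCentre G ↔ (centralizer {g}).FiniteIndex := Iff.rfl

theorem exists_index_le_of_chainBounded (h : ChainBounded G) :
    ∃ m, ∀ g ∈ almostCentre G, (centralizer {g}).index ≤ m := by
  by_contra! hm
  obtain ⟨k, hk⟩ := h
  suffices ∀ (r : ℕ) (H : Subgroup G), H.FiniteIndex → HasChain k r H from
    hk (this k ⊤ inferInstance)
  intro r
  induction r with
  | zero => exact fun _ _ => trivial
  | succ r ih =>
    intro H hH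
    -- The factor `H.index` is the most that can be lost when the index of the centraliser is
    -- measured inside `H`.
    obtain ⟨g, hg, hlt⟩ := hm (k * H.index)
    have hgf : (centralizer {g}).FiniteIndex := hg
    refine ⟨g, hasOrbit_iff.2 (Or.inr ?_), ih _ inferInstance⟩
    by_contra! hlt'
    have h1 := relIndex_mul_index (inf_le_right : centralizer {g} ⊓ H ≤ H)
    rw [inf_relIndex_right] at h1
    have h2 : (centralizer {g}).index ≤ (centralizer {g} ⊓ H).index :=
      index_antitone inf_le_left
    rw [← h1] at h2
    exact absurd (h2.trans (Nat.mul_le_mul_right _ hlt'.le)) hlt.not_ge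

/-- With a uniform bound, membership becomes a first-order condition: fewer than `m` conjugates. -/
theorem exists_mem_almostCentre_iff (h : ChainBounded G) :
    ∃ m, ∀ g, g ∈ almostCentre G ↔ ¬ HasOrbit m ⊤ g := by
  obtain ⟨m, hm⟩ := exists_index_le_of_chainBounded h
  refine ⟨m + 1, fun g => ?_⟩
  rw [hasOrbit_iff, relIndex_top_right, mem_almostCentre, finiteIndex_iff, not_or, not_le]
  refine ⟨fun hg => ⟨hg, Nat.lt_succ_of_le (hm g (finiteIndex_iff.2 hg))⟩, fun hg => hg.1⟩

/-- B. H. Neumann's lemma for subgroups covering a subgroup. -/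
theorem exists_isFiniteRelIndex_of_cover {ι : Type*} (s : Finset ι) (D : ι → Subgroup G)
    (H : Subgroup G) (h : ∀ x ∈ H, ∃ i ∈ s, x ∈ D i) : ∃ i ∈ s, (D i).relIndex H ≠ 0 := by
  obtain ⟨i, hi, hf⟩ := exists_finiteIndex_of_leftCoset_cover (G := H) (s := s)
    (H := fun i => (D i).subgroupOf H) (g := fun _ => 1) (by
      refine Set.eq_univ_of_forall fun x => ?_
      obtain ⟨i, hi, hx⟩ := h x x.2
      exact Set.mem_biUnion hi (by simpa [mem_subgroupOf] using hx))
  exact ⟨i, hi, hf.index_ne_zero⟩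

theorem centralizer_union_singleton (F : Set G) (g : G) :
    centralizer (F ∪ {g}) = centralizer F ⊓ centralizer {g} := by
  ext y
  simp only [mem_centralizer_iff, mem_inf, Set.mem_union, or_imp, forall_and]

/-- Enlarge `F` until every element has fewer than `k` conjugates under `H = centralizer F`. If `H`
were infinite, take `k` elements of `H` in distinct cosets of the finite almost centre. Every `g`
then commutes with a quotient of two of them, so `G` is a finite union of centralisers; by Neumann's
lemma one has finite index, and the corresponding quotient lies in the almost centre. -/
theorem exists_finite_centralizer (h : ChainBounded G) (hZ : (almostCentre G : Set G).Finite) :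
    ∃ F : Set G, F.Finite ∧ (centralizer F : Set G).Finite := by
  obtain ⟨k, hk⟩ := h
  have key : ∀ (r : ℕ) (F : Set G), F.Finite → ¬ HasChain k r (centralizer F) →
      ∃ F' : Set G, F'.Finite ∧ ∀ g, ¬ HasOrbit k (centralizer F') g := by
    intro r
    induction r with
    | zero => exact fun _ _ h => absurd trivial h
    | succ r ih =>
      intro F hF hc
      by_cases hg : ∃ g, HasOrbit k (centralizer F) g
      · obtain ⟨g, hg⟩ := hg
        refine ih (F ∪ {g}) (hF.union (Set.finite_singleton g)) fun hc' => hc ⟨g, hg, ?_⟩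
        rwa [centralizer_union_singleton] at hc'
      · exact ⟨F, hF, not_exists.1 hg⟩
  obtain ⟨F, hF, hFg⟩ := key k ∅ Set.finite_empty (by
    have h0 : centralizer (∅ : Set G) = ⊤ := by ext; simp [mem_centralizer_iff]
    rwa [h0])
  refine ⟨F, hF, ?_⟩
  by_contra hinf
  set H := centralizer F
  have : Infinite (H ⧸ (almostCentre G).subgroupOf H) := by
    by_contra hn
    rw [not_infinite_iff_finite] at hn
    have h1 : Finite ((almostCentre G).subgroupOf H) := by
      have : Finite (almostCentre G) := hZ
      exact Finite.of_injective (fun a => (⟨a.1.1, a.2⟩ : almostCentre G)) fun a b hab =>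
        Subtype.ext (Subtype.ext (Subtype.mk.inj hab))
    have h2 : ((almostCentre G).subgroupOf H).FiniteIndex := finiteIndex_of_finite_quotient
    exact hinf (((almostCentre G).subgroupOf H).finite_iff_finite_and_finiteIndex.2 ⟨h1, h2⟩)
  let f := (Fin.valEmbedding (n := k)).trans
    (Infinite.natEmbedding (H ⧸ (almostCentre G).subgroupOf H))
  let y : Fin k → H := fun a => (f a).out
  obtain ⟨⟨a, b⟩, hab, hD⟩ := exists_isFiniteRelIndex_of_cover
    (Finset.univ.filter fun p : Fin k × Fin k => p.1 ≠ p.2)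
    (fun p => centralizer {((y p.1)⁻¹ * y p.2 : G)}) ⊤ (by
      intro g _
      by_contra! hno
      refine hFg g ⟨fun a => y a, fun a => (y a).2, fun a b hab hc => ?_⟩
      refine hno (a, b) (by simpa using hab) ?_
      rw [mem_centralizer_singleton_iff] at hc ⊢
      exact hc.symm)
  rw [relIndex_top_right] at hD
  have hmem : ((y a)⁻¹ * y b : G) ∈ almostCentre G := mem_almostCentre.2 ⟨hD⟩
  have hne : a ≠ b := by simpa using hab
  refine hne (f.injective ?_)
  rw [← (f a).out_eq', ← (f b).out_eq']
  exact QuotientGroup.eq.2 (by simpa [mem_subgroupOf] using hmem)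

end ChainCondition

/-! ### Locally nilpotent groups with finite almost centre -/

section LocallyNilpotent

variable {G : Type x} [Group G]

theorem IsLocallyNilpotent.of_surjective {H : Type*} [Group H] (hG : IsLocallyNilpotent G)
    (f : G →* H) (hf : Function.Surjective f) : IsLocallyNilpotent H := by
  rintro K ⟨S, hS⟩
  choose s hs using hf
  classical
  let K' := closure ((S.image s : Finset G) : Set G)
  have hK' : K'.map f = K := by
    rw [MonoidHom.map_closure, ← hS]
    congr 1
    ext y
    simp [hs]
  have := hG K' ⟨_, rfl⟩
  subst hK'
  exact Group.nilpotent_of_surjective (f.subgroupMap K') (f.subgroupMap_surjective K')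

/-- The elements commuting with a finite set modulo a finite normal subgroup are finite in number
if the set has finite centraliser. -/
theorem finite_centralizer_mod {F : Set G} (hF : F.Finite)
    (hC : (centralizer F : Set G).Finite) {N : Subgroup G} (hN : (N : Set G).Finite) :
    {g : G | ∀ f ∈ F, g * f * g⁻¹ * f⁻¹ ∈ N}.Finite := by
  have : Finite F := hF
  refine Set.Finite.of_finite_fibers (fun (g : G) (f : F) => g * f * g⁻¹ * (f : G)⁻¹)
    ((Set.Finite.pi' fun _ : F => hN).subset ?_) ?_
  · rintro _ ⟨g, hg, rfl⟩ f
    exact hg f f.2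
  · rintro _ ⟨g₀, -, rfl⟩
    refine Set.Finite.of_finite_image (f := fun g => g₀⁻¹ * g) (hC.subset ?_)
      (mul_right_injective g₀⁻¹).injOn
    rintro _ ⟨g, ⟨-, hg⟩, rfl⟩
    rw [SetLike.mem_coe, mem_centralizer_iff]
    intro f hf
    have h2 : g * f * g⁻¹ = g₀ * f * g₀⁻¹ := mul_right_cancel (congrFun hg ⟨f, hf⟩)
    calc f * (g₀⁻¹ * g) = g₀⁻¹ * (g₀ * f * g₀⁻¹) * g := by group
      _ = g₀⁻¹ * g * f := by rw [← h2]; group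

theorem finite_of_finite_almostCentre (hG : IsLocallyNilpotent G) (h : ChainBounded G)
    (hZ : (almostCentre G : Set G).Finite) : Finite G := by
  obtain ⟨F, hF, hC⟩ := exists_finite_centralizer h hZ
  set N := almostCentre G
  suffices hN : N = ⊤ by
    rw [hN] at hZ
    exact Set.finite_univ_iff.1 (by simpa using hZ)
  by_contra hne
  obtain ⟨t, ht⟩ : ∃ t, t ∉ N := by
    by_contra! hall
    exact hne (eq_top_iff.2 fun x _ => hall x)
  have hB := finite_centralizer_mod hF hC hZ
  set B := {g : G | ∀ f ∈ F, g * f * g⁻¹ * f⁻¹ ∈ N}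
  -- If all commutators of `x` lay in the finite group `N`, then `y ↦ x * y * x⁻¹ * y⁻¹` would embed
  -- the cosets of its centraliser in `N`, placing `x` in the almost centre.
  have hx : ∀ x : G, x ∉ N → ∃ y, x * y * x⁻¹ * y⁻¹ ∉ N := by
    intro x hx
    by_contra! hall
    apply hx
    have hfin : Finite (G ⧸ centralizer {x}) := by
      have : Finite N := hZ
      refine Finite.of_injective (β := N) (Quotient.lift
        (fun y : G => (⟨x * y * x⁻¹ * y⁻¹, hall y⟩ : N)) ?_) ?_
      · intro a b hab
        have hab' : a⁻¹ * b ∈ centralizer {x} := QuotientGroup.leftRel_apply.1 hab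
        rw [mem_centralizer_singleton_iff] at hab'
        refine Subtype.ext ?_
        have h1 : b * x⁻¹ * b⁻¹ = a * x⁻¹ * a⁻¹ := by
          have h2 : b * x = a * x * a⁻¹ * b := by
            calc b * x = a * (a⁻¹ * b * x) := by group
              _ = _ := by rw [hab']; group
          have h3 : b * x * b⁻¹ = a * x * a⁻¹ := by rw [h2]; group
          have := congrArg (·⁻¹) h3
          simpa [mul_assoc] using this
        show x * a * x⁻¹ * a⁻¹ = x * b * x⁻¹ * b⁻¹
        calc x * a * x⁻¹ * a⁻¹ = x * (a * x⁻¹ * a⁻¹) := by group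
          _ = _ := by rw [← h1]; group
      · intro a b
        induction a using Quotient.inductionOn with | _ a
        induction b using Quotient.inductionOn with | _ b
        intro hab
        have hab' : x * a * x⁻¹ * a⁻¹ = x * b * x⁻¹ * b⁻¹ := congrArg Subtype.val hab
        refine Quotient.sound (QuotientGroup.leftRel_apply.2 ?_)
        rw [mem_centralizer_singleton_iff]
        have h1 : a * x⁻¹ * a⁻¹ = b * x⁻¹ * b⁻¹ := by
          apply mul_left_cancel (a := x)
          simpa [mul_assoc] using hab'
        have h3 : a * x * a⁻¹ = b * x * b⁻¹ := by
          have := congrArg (·⁻¹) h1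
          simpa [mul_assoc] using this
        calc a⁻¹ * b * x = a⁻¹ * (b * x * b⁻¹) * b := by group
          _ = x * (a⁻¹ * b) := by rw [← h3]; group
    exact mem_almostCentre.2 finiteIndex_of_finite_quotient
  choose! c hc using hx
  classical
  -- The element `t` keeps the image modulo `N` nontrivial, `F` forces central elements of the image
  -- to come from `B`, and `c '' B` prevents them from being central.
  let S : Set G := insert t (F ∪ c '' B)
  have hS : S.Finite := (hF.union (hB.image c)).insert t
  let H := closure S
  have hHnil := hG H ((fg_iff _).2 ⟨S, rfl, hS⟩)
  let H' := H.map (QuotientGroup.mk' N)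
  have hH'nil : Group.IsNilpotent H' :=
    Group.nilpotent_of_surjective ((QuotientGroup.mk' N).subgroupMap H)
      ((QuotientGroup.mk' N).subgroupMap_surjective H)
  have hSH : ∀ s ∈ S, (s : G ⧸ N) ∈ H' := fun s hs => ⟨s, subset_closure hs, rfl⟩
  have hnt : Nontrivial H' := by
    refine ⟨⟨⟨t, hSH t (Set.mem_insert _ _)⟩, 1, fun heq => ht ?_⟩⟩
    exact (QuotientGroup.eq_one_iff t).1 (congrArg Subtype.val heq)
  obtain ⟨⟨⟨_, x, hxH, rfl⟩, hzc⟩, hz1⟩ := Subgroup.ne_bot_iff_exists_ne_one.1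
    (Group.IsNilpotent.center_ne_bot (G := H'))
  have hxN : x ∉ N := fun hxN => hz1 <| Subtype.ext <| Subtype.ext <|
    (QuotientGroup.eq_one_iff x).2 hxN
  have hcomm : ∀ s ∈ S, x * s * x⁻¹ * s⁻¹ ∈ N := by
    intro s hs
    have h1 := congrArg Subtype.val (mem_center_iff.1 hzc ⟨s, hSH s hs⟩)
    have h2 : (s : G ⧸ N) * x = x * s := h1
    rw [← QuotientGroup.eq_one_iff]
    calc ((x * s * x⁻¹ * s⁻¹ : G) : G ⧸ N) = (x * s : G ⧸ N) * (x : G ⧸ N)⁻¹ * (s : G ⧸ N)⁻¹ := rfl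
      _ = 1 := by rw [← h2]; group
  have hxB : x ∈ B := fun f hf => hcomm f (Or.inr (Or.inl hf))
  exact hc x hxN (hcomm _ (Or.inr (Or.inr ⟨x, hxB, rfl⟩)))

end LocallyNilpotent

end FinDim

namespace FinDim

open Subgroup
open scoped Pointwise

/-! ### Lifting nilpotency from the quotient by the almost centre -/

section VirtuallyNilpotent

variable {G : Type x} [Group G]

theorem finite_range_conj {t : G} (ht : (centralizer {t}).FiniteIndex) :
    (Set.range fun k : G => k * t * k⁻¹).Finite := by
  have : Finite (G ⧸ centralizer {t}) := finite_quotient_of_finiteIndex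
  refine (Set.finite_range fun q : G ⧸ centralizer {t} => q.out * t * q.out⁻¹).subset ?_
  rintro _ ⟨k, rfl⟩
  refine ⟨QuotientGroup.mk k, ?_⟩
  have h := QuotientGroup.eq.1 (QuotientGroup.mk k : G ⧸ centralizer {t}).out_eq'
  rw [mem_centralizer_singleton_iff] at h
  set o := (QuotientGroup.mk k : G ⧸ centralizer {t}).out
  calc o * t * o⁻¹ = o * (t * (o⁻¹ * k)) * k⁻¹ := by group
    _ = k * t * k⁻¹ := by rw [← h]; group

/-- The elements whose centraliser in `H` has finite index in `H`. -/
def almostCentralizer (H : Subgroup G) : Subgroup G where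
  carrier := {g | (centralizer {g}).relIndex H ≠ 0}
  one_mem' := by
    have h : centralizer ({1} : Set G) = ⊤ := by
      ext y; simp [mem_centralizer_singleton_iff]
    simp [h]
  mul_mem' {a b} ha hb := by
    refine mt (relIndex_eq_zero_of_le_left ?_) (relIndex_inf_ne_zero ha hb)
    intro y hy
    have hya := mem_centralizer_singleton_iff.1 hy.1
    have hyb := mem_centralizer_singleton_iff.1 hy.2
    exact mem_centralizer_singleton_iff.2
      (Commute.mul_right (show Commute y a from hya) hyb).eq
  inv_mem' {a} ha := by
    refine mt (relIndex_eq_zero_of_le_left ?_) ha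
    intro y hy
    rw [mem_centralizer_singleton_iff] at *
    exact (Commute.inv_right (show Commute y a from hy)).eq

/-- Given `m` elements in distinct cosets, each `h ∈ H` commutes with a quotient of two of them. So
`H` is covered by finitely many centralisers, and Neumann's lemma puts one such quotient in
`almostCentralizer H`. -/
theorem finiteIndex_almostCentralizer {H : Subgroup G} {m : ℕ}
    (hm : ∀ h ∈ H, ¬ HasOrbit m ⊤ h) : (almostCentralizer H).FiniteIndex := by
  by_contra hK
  have : Infinite (G ⧸ almostCentralizer H) := by
    by_contra hn
    rw [not_infinite_iff_finite] at hn
    exact hK finiteIndex_of_finite_quotient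
  let f := (Fin.valEmbedding (n := m)).trans (Infinite.natEmbedding (G ⧸ almostCentralizer H))
  let y : Fin m → G := fun a => (f a).out
  obtain ⟨⟨a, b⟩, hab, hD⟩ := exists_isFiniteRelIndex_of_cover
    (Finset.univ.filter fun p : Fin m × Fin m => p.1 ≠ p.2)
    (fun p => centralizer {(y p.1)⁻¹ * y p.2}) H (by
      intro g hg
      by_contra! hno
      refine hm g hg ⟨y, fun _ => mem_top _, fun a b hab hc => ?_⟩
      refine hno (a, b) (by simpa using hab) ?_
      rw [mem_centralizer_singleton_iff] at hc ⊢
      exact hc.symm)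
  have hne : a ≠ b := by simpa using hab
  refine hne (f.injective ?_)
  rw [← (f a).out_eq', ← (f b).out_eq']
  exact QuotientGroup.eq.2 hD

/-- An element with the most conjugates under `K` among those of `H`. -/
theorem exists_maximal_orbit {H K : Subgroup G} {m : ℕ} (hm : ∀ h ∈ H, ¬ HasOrbit m ⊤ h) :
    ∃ (r : ℕ) (h₀ : G) (y : Fin r → G), h₀ ∈ H ∧ (∀ a, y a ∈ K) ∧
      ∀ c ∈ H, (∀ a, y a * c = c * y a) → ∀ k ∈ K, ∃ a, (y a)⁻¹ * k ∈ centralizer {c * h₀} := by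
  classical
  have hbound : ∀ r, (∃ h ∈ H, HasOrbit r K h) → r ≤ m := by
    rintro r ⟨h, hh, y, -, hy⟩
    by_contra! hlt
    exact hm h hh ⟨fun a => y (Fin.castLE hlt.le a), fun _ => mem_top _,
      fun a b hab => hy _ _ (by simpa [Fin.ext_iff] using hab)⟩
  have h0 : ∃ h ∈ H, HasOrbit 0 K h := ⟨1, one_mem _, Fin.elim0, fun a => a.elim0, fun a => a.elim0⟩
  set r := Nat.findGreatest (fun r => ∃ h ∈ H, HasOrbit r K h) m with hr
  obtain ⟨h₀, hh₀, y, hyK, hy⟩ : ∃ h ∈ H, HasOrbit r K h :=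
    Nat.findGreatest_spec (P := fun r => ∃ h ∈ H, HasOrbit r K h) (Nat.zero_le m) h0
  refine ⟨r, h₀, y, hh₀, hyK, fun c hc hcy k hk => ?_⟩
  by_contra! hno
  have hsucc : ∃ h ∈ H, HasOrbit (r + 1) K h := by
    refine ⟨c * h₀, mul_mem hc hh₀, Fin.cons k y, Fin.cases hk hyK, ?_⟩
    intro a b
    cases a using Fin.cases with
    | zero =>
      cases b using Fin.cases with
      | zero => exact fun h => absurd rfl h
      | succ b =>
        intro _ hmem
        apply hno b
        simpa using inv_mem hmem
    | succ a =>
      cases b using Fin.cases with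
      | zero => exact fun _ => hno a
      | succ b =>
        intro hab hmem
        refine hy a b (fun h => hab (congrArg _ h)) ?_
        simp only [Fin.cons_succ] at hmem
        rw [mem_centralizer_singleton_iff] at hmem ⊢
        -- As `c` commutes with every `y a`, the `y a` still separate conjugates of `c * h₀`; a
        -- further coset would exceed the maximum `r`.
        have hcomm : Commute ((y a)⁻¹ * y b) c :=
          Commute.mul_left (Commute.inv_left (hcy a)) (hcy b)
        have := (Commute.mul_right hcomm.inv_right (show Commute _ (c * h₀) from hmem)).eq
        simpa using this
  exact absurd (Nat.le_findGreatest (P := fun r => ∃ h ∈ H, HasOrbit r K h)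
    (hbound _ hsucc) hsucc) (Nat.not_succ_le_self r)

/-- If the elements of `H` have boundedly many conjugates, and the elements of `K` have
centralisers of finite index in `H`, then there are only finitely many commutators. -/
theorem finite_commutators {H K : Subgroup G} {m : ℕ} (hm : ∀ h ∈ H, ¬ HasOrbit m ⊤ h)
    (hK : K ≤ almostCentralizer H) :
    {s | ∃ h ∈ H, ∃ k ∈ K, s = h * k * h⁻¹ * k⁻¹}.Finite := by
  have hconj : ∀ h ∈ H, (Set.range fun k : G => k * h * k⁻¹).Finite := by
    intro h hh
    refine finite_range_conj ⟨?_⟩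
    have := hm h hh
    rw [hasOrbit_iff, relIndex_top_right, not_or] at this
    exact this.1
  obtain ⟨r, h₀, y, hh₀, hyK, hmax⟩ := exists_maximal_orbit (K := K) hm
  let C := ⨅ a, centralizer {y a}
  have hC : C.relIndex H ≠ 0 := relIndex_iInf_ne_zero fun a => hK (hyK a)
  have : Finite (H ⧸ C.subgroupOf H) := Nat.finite_of_card_ne_zero hC
  let R : G → Set G := fun h => Set.range fun k : G => k * h * k⁻¹
  -- By maximality, `k` and some `y a` conjugate `c⁻¹ * h₀` alike, and `y a` commutes with `c`.
  -- Solving for the commutator of `c` and `k` gives a conjugate of `h₀` times the inverse of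
  -- another.
  have hmain : ∀ c ∈ H, c ∈ C → ∀ k ∈ K, c * k * c⁻¹ * k⁻¹ ∈ R h₀ * (R h₀)⁻¹ := by
    intro c hcH hcC k hk
    have hcy : ∀ a, y a * c⁻¹ = c⁻¹ * y a := fun a =>
      (Commute.inv_left (mem_centralizer_singleton_iff.1 (mem_iInf.1 hcC a))).eq.symm
    obtain ⟨a, ha⟩ := hmax c⁻¹ (inv_mem hcH) hcy k hk
    rw [mem_centralizer_singleton_iff] at ha
    refine Set.mem_mul.2 ⟨y a * h₀ * (y a)⁻¹, ⟨_, rfl⟩, (k * h₀ * k⁻¹)⁻¹,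
      Set.inv_mem_inv.2 ⟨_, rfl⟩, ?_⟩
    have h1 : k * (c⁻¹ * h₀) * k⁻¹ = c⁻¹ * (y a * h₀ * (y a)⁻¹) := by
      calc k * (c⁻¹ * h₀) * k⁻¹ = y a * ((y a)⁻¹ * k * (c⁻¹ * h₀)) * k⁻¹ := by group
        _ = (y a * c⁻¹) * h₀ * (y a)⁻¹ := by rw [ha]; group
        _ = _ := by rw [hcy a]; group
    calc y a * h₀ * (y a)⁻¹ * (k * h₀ * k⁻¹)⁻¹
        = c * (c⁻¹ * (y a * h₀ * (y a)⁻¹)) * (k * h₀ * k⁻¹)⁻¹ := by group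
      _ = c * k * c⁻¹ * k⁻¹ := by rw [← h1]; group
  -- For `h = t * c` with `t` a coset representative of `C` in `H`, the commutator of `h` and `k` is
  -- `t`, times that of `c` and `k`, times `k * t⁻¹ * k⁻¹`; each factor has finitely many values.
  have hfin : (⋃ q : H ⧸ C.subgroupOf H,
      ({((q.out : H) : G)} : Set G) * (R h₀ * (R h₀)⁻¹) * R ((q.out : G)⁻¹)).Finite :=
    Set.finite_iUnion fun q => ((Set.finite_singleton _).mul
      ((hconj _ hh₀).mul (hconj _ hh₀).inv)).mul (hconj _ (inv_mem q.out.2))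
  refine hfin.subset ?_
  rintro _ ⟨h, hh, k, hk, rfl⟩
  let q : H ⧸ C.subgroupOf H := QuotientGroup.mk ⟨h, hh⟩
  have hq : (q.out : G)⁻¹ * h ∈ C := by
    have := QuotientGroup.eq.1 (q.out_eq' : QuotientGroup.mk q.out = QuotientGroup.mk ⟨h, hh⟩)
    simpa [mem_subgroupOf] using this
  refine Set.mem_iUnion.2 ⟨q, ?_⟩
  set t : G := Subtype.val (Quotient.out q)
  have hc := hmain (t⁻¹ * h) (mul_mem (inv_mem q.out.2) hh) hq k hk
  refine Set.mem_mul.2 ⟨_, Set.mul_mem_mul rfl hc, k * t⁻¹ * k⁻¹, ⟨k, rfl⟩, ?_⟩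
  group

theorem isVirtuallyNilpotent_of_quotient_almostCentre {m : ℕ}
    (hm : ∀ h ∈ almostCentre G, ¬ HasOrbit m ⊤ h)
    (hQ : Group.IsVirtuallyNilpotent (G ⧸ almostCentre G)) : Group.IsVirtuallyNilpotent G := by
  obtain ⟨Q, hQnil, hQfin⟩ := hQ
  set H := almostCentre G
  have hK := finiteIndex_almostCentralizer hm
  set K := almostCentralizer H
  have hS := finite_commutators hm (le_refl K)
  set S := {s | ∃ h ∈ H, ∃ k ∈ K, s = h * k * h⁻¹ * k⁻¹}
  have hCS : (⨅ s : S, centralizer {(s : G)}).FiniteIndex := by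
    have : Finite S := hS
    refine finiteIndex_iInf fun s => ?_
    obtain ⟨_, h, hh, k, -, rfl⟩ := s
    show h * k * h⁻¹ * k⁻¹ ∈ almostCentre G
    have := mul_mem hh ((almostCentre_normal G).conj_mem _ (inv_mem hh) k)
    simpa [mul_assoc] using this
  have hQ' : (Q.comap (QuotientGroup.mk' H)).FiniteIndex := by
    refine ⟨?_⟩
    rw [index_comap_of_surjective _ (QuotientGroup.mk'_surjective H)]
    exact hQfin.index_ne_zero
  -- If `Q` has class at most `n`, the `n`-th term of the series of `P` falls into `H`, the next
  -- into commutators of `H` with `K`, which `P` centralises, and the one after is trivial.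
  let P := (K ⊓ ⨅ s : S, centralizer {(s : G)}) ⊓ Q.comap (QuotientGroup.mk' H)
  refine ⟨P, ?_, inferInstance⟩
  obtain ⟨n, hn⟩ := Q.isNilpotent_iff_lowerCentralSeries.1 hQnil
  refine P.isNilpotent_iff_lowerCentralSeries.2 ⟨n + 2, ?_⟩
  have h0 : P.lowerCentralSeries n ≤ H := by
    have h1 : (P.lowerCentralSeries n).map (QuotientGroup.mk' H) ≤ ⊥ := by
      rw [map_lowerCentralSeries, ← hn]
      exact lowerCentralSeries_mono n (map_le_iff_le_comap.2 inf_le_right)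
    intro z hz
    exact (QuotientGroup.eq_one_iff z).1 (mem_bot.1 (h1 ⟨z, hz, rfl⟩))
  have h1 : P.lowerCentralSeries (n + 1) ≤ centralizer (P : Set G) := by
    rw [Subgroup.lowerCentralSeries_succ, commutator_le]
    intro h hh k hk
    rw [mem_centralizer_iff]
    intro p hp
    exact mem_centralizer_singleton_iff.1
      (mem_iInf.1 hp.1.2 ⟨h * k * h⁻¹ * k⁻¹, h, h0 hh, k, hk.1.1, rfl⟩)
  rw [Subgroup.lowerCentralSeries_succ, eq_bot_iff, commutator_le]
  intro a ha b hb
  rw [mem_bot, commutatorElement_eq_one_iff_mul_comm]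
  exact ((mem_centralizer_iff.1 (h1 ha)) b hb).symm

/-- Indices and commutation relations pull back along surjections, so only the kernel matters. This
replaces explicit isomorphisms between iterated quotients. -/
theorem comap_almostCentre_eq {A B : Type*} [Group A] [Group B] (φ : G →* A) (ψ : G →* B)
    (hφ : Function.Surjective φ) (hψ : Function.Surjective ψ) (h : φ.ker = ψ.ker) :
    (almostCentre A).comap φ = (almostCentre B).comap ψ := by
  ext g
  rw [mem_comap, mem_comap, mem_almostCentre, mem_almostCentre, finiteIndex_iff, finiteIndex_iff,
    ← index_comap_of_surjective _ hφ, ← index_comap_of_surjective _ hψ]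
  suffices (centralizer {φ g}).comap φ = (centralizer {ψ g}).comap ψ by rw [this]
  ext y
  rw [mem_comap, mem_comap, mem_centralizer_singleton_iff, mem_centralizer_singleton_iff,
    ← map_mul, ← map_mul, ← map_mul, ← map_mul, MonoidHom.eq_iff, MonoidHom.eq_iff, h]

instance iteratedAlmostCentre_normal (n : ℕ) : (iteratedAlmostCentre G n).Normal :=
  (iteratedAlmostCentreAux G n).2

theorem iteratedAlmostCentre_succ_eq (n : ℕ) :
    iteratedAlmostCentre G (n + 1) =
      (almostCentre (G ⧸ iteratedAlmostCentre G n)).comap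
        (QuotientGroup.mk' (iteratedAlmostCentre G n)) := rfl

theorem iteratedAlmostCentre_one : iteratedAlmostCentre G 1 = almostCentre G := by
  have h0 : iteratedAlmostCentre G 0 = ⊥ := rfl
  rw [iteratedAlmostCentre_succ_eq, comap_almostCentre_eq _ (MonoidHom.id G) (QuotientGroup.mk'_surjective _)
    Function.surjective_id, comap_id]
  rw [QuotientGroup.ker_mk', MonoidHom.ker_id, h0]

/-- The definition adds a layer on top; the induction on dimension removes the bottom one. -/
theorem iteratedAlmostCentre_succ (n : ℕ) :
    iteratedAlmostCentre G (n + 1) =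
      (iteratedAlmostCentre (G ⧸ almostCentre G) n).comap (QuotientGroup.mk' (almostCentre G)) := by
  induction n with
  | zero =>
    rw [iteratedAlmostCentre_one]
    have h0 : iteratedAlmostCentre (G ⧸ almostCentre G) 0 = ⊥ := rfl
    rw [h0, MonoidHom.comap_bot, QuotientGroup.ker_mk']
  | succ n ih =>
    rw [iteratedAlmostCentre_succ_eq (n + 1), iteratedAlmostCentre_succ_eq (G := G ⧸ almostCentre G) n,
      comap_comap]
    refine comap_almostCentre_eq _ _ (QuotientGroup.mk'_surjective _)
      ((QuotientGroup.mk'_surjective _).comp (QuotientGroup.mk'_surjective _)) ?_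
    rw [← MonoidHom.comap_ker, QuotientGroup.ker_mk', QuotientGroup.ker_mk', ih]

theorem isAlmostNilpotent_of_quotient_almostCentre
    (h : IsAlmostNilpotent (G ⧸ almostCentre G)) : IsAlmostNilpotent G := by
  obtain ⟨n, hn⟩ := h
  exact ⟨n + 1, by rw [iteratedAlmostCentre_succ, hn, comap_top]⟩

theorem isAlmostNilpotent_of_finite [Finite G] : IsAlmostNilpotent G := by
  refine ⟨1, ?_⟩
  rw [iteratedAlmostCentre_one, eq_top_iff]
  exact fun g _ => mem_almostCentre.2 inferInstance

theorem isVirtuallyNilpotent_of_finite [Finite G] : Group.IsVirtuallyNilpotent G :=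
  ⟨⊥, inferInstance, inferInstance⟩

end VirtuallyNilpotent

end FinDim

namespace FinDim

/-! ### Definability of conditions on coded elements -/

section Coding

theorem definable_of_iff {L : FirstOrder.Language.{u, v}} {M : Type w} [L.Structure M]
    {α : Type*} {s t : Set (α → M)} (hs : (Set.univ : Set M).Definable L s)
    (h : ∀ p, p ∈ s ↔ p ∈ t) : (Set.univ : Set M).Definable L t := by
  rwa [← Set.ext h]

/-- A coding of the elements of `A` by `n`-tuples from `M`; an element may have several codes, and
the relation of coding the same element is definable with parameters. -/
structure Coding (L : FirstOrder.Language.{u, v}) (M : Type w) [L.Structure M] (A : Type x)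
    (n : ℕ) where
  /-- the element coded by a tuple, if there is one -/
  decode : (Fin n → M) → Option A
  surjective : ∀ a, ∃ v, decode v = some a
  definable_eq : (Set.univ : Set M).Definable L {p : Fin 2 × Fin n → M |
    ∃ a, decode (fun j => p (0, j)) = some a ∧ decode (fun j => p (1, j)) = some a}

variable {L : FirstOrder.Language.{u, v}} {M : Type w} [L.Structure M] {A : Type x} {n : ℕ}

namespace Coding

variable (c : Coding L M A n) {ι κ : Type}

/-- The codes of the tuples `g` in `A` satisfying `P` form a definable set. -/
def IsDef (P : (ι → A) → Prop) : Prop :=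
  (Set.univ : Set M).Definable L {p : ι × Fin n → M |
    ∃ g : ι → A, (∀ i, c.decode (fun j => p (i, j)) = some (g i)) ∧ P g}

/-- The graph of `t` is definable in terms of codes. -/
def IsDefFun (t : (ι → A) → A) : Prop :=
  c.IsDef fun g : ι ⊕ Unit → A => t (g ∘ Sum.inl) = g (Sum.inr ())

variable {c}

theorem decode_unique {p : ι × Fin n → M} {g g' : ι → A}
    (h : ∀ i, c.decode (fun j => p (i, j)) = some (g i))
    (h' : ∀ i, c.decode (fun j => p (i, j)) = some (g' i)) : g = g' :=
  funext fun i => Option.some_injective _ ((h i).symm.trans (h' i))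

theorem IsDef.and {P Q : (ι → A) → Prop} (hP : c.IsDef P) (hQ : c.IsDef Q) :
    c.IsDef fun g => P g ∧ Q g := by
  refine definable_of_iff (hP.inter hQ) fun p => ?_
  constructor
  · rintro ⟨⟨g, hg, h⟩, g', hg', h'⟩
    obtain rfl := decode_unique hg hg'
    exact ⟨g, hg, h, h'⟩
  · rintro ⟨g, hg, h, h'⟩
    exact ⟨⟨g, hg, h⟩, g, hg, h'⟩

theorem IsDef.congr {P Q : (ι → A) → Prop} (hP : c.IsDef P) (h : ∀ g, P g ↔ Q g) :
    c.IsDef Q := by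
  rwa [← funext fun g => propext (h g)]

variable (c) in
-- A tuple is a code exactly when it codes the same element as itself, so the codes form the
-- diagonal of `definable_eq`.
theorem isDef_true [Finite ι] : c.IsDef fun _ : ι → A => True := by
  have h := Set.definable_iInter_of_finite (fun i : ι => c.definable_eq.preimage_comp
    (fun q : Fin 2 × Fin n => (i, q.2)))
  refine definable_of_iff h fun p => ?_
  simp only [Set.mem_iInter, Set.mem_preimage, Set.mem_ofPred_eq, Function.comp_def, and_self,
    and_true]
  exact Classical.skolem

theorem IsDef.not [Finite ι] {P : (ι → A) → Prop} (hP : c.IsDef P) : c.IsDef fun g => ¬ P g := by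
  refine definable_of_iff (c.isDef_true.sdiff hP) fun p => ?_
  constructor
  · rintro ⟨⟨g, hg, -⟩, h⟩
    exact ⟨g, hg, fun hPg => h ⟨g, hg, hPg⟩⟩
  · rintro ⟨g, hg, h⟩
    refine ⟨⟨g, hg, trivial⟩, ?_⟩
    rintro ⟨g', hg', h'⟩
    exact h (decode_unique hg hg' ▸ h')

theorem IsDef.reindex [Finite κ] {P : (ι → A) → Prop} (hP : c.IsDef P) (f : ι → κ) :
    c.IsDef fun g : κ → A => P (g ∘ f) := by
  refine definable_of_iff (c.isDef_true.inter (hP.preimage_comp (Prod.map f id))) fun p => ?_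
  constructor
  · rintro ⟨⟨g, hg, -⟩, g', hg', h⟩
    refine ⟨g, hg, ?_⟩
    show P (g ∘ f)
    rwa [decode_unique (g := g ∘ f) (fun i => hg (f i)) hg']
  · rintro ⟨g, hg, h⟩
    exact ⟨⟨g, hg, trivial⟩, g ∘ f, fun i => hg (f i), h⟩

theorem IsDef.exists [Finite κ] {P : (ι → A) → (κ → A) → Prop}
    (hP : c.IsDef fun g : ι ⊕ κ → A => P (g ∘ Sum.inl) (g ∘ Sum.inr)) :
    c.IsDef fun g => ∃ h, P g h := by
  have h1 := Set.Definable.preimage_comp (Equiv.sumProdDistrib ι κ (Fin n)) hP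
  refine definable_of_iff h1.exists_of_finite fun p => ?_
  constructor
  · rintro ⟨q, g, hg, h⟩
    exact ⟨g ∘ Sum.inl, fun i => hg (Sum.inl i), g ∘ Sum.inr, h⟩
  · rintro ⟨g, hg, h, hP⟩
    choose q hq using fun i => c.surjective (h i)
    refine ⟨fun i => q i.1 i.2, Sum.elim g h, ?_, hP⟩
    rintro (i | i)
    · exact hg i
    · exact hq i

theorem IsDef.forall_finite [Finite ι] {α : Type*} [Finite α] {P : α → (ι → A) → Prop}
    (hP : ∀ a, c.IsDef (P a)) : c.IsDef fun g => ∀ a, P a g := by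
  refine definable_of_iff (c.isDef_true.inter (Set.definable_iInter_of_finite hP)) fun p => ?_
  constructor
  · rintro ⟨⟨g, hg, -⟩, h⟩
    refine ⟨g, hg, fun a => ?_⟩
    obtain ⟨g', hg', h'⟩ := Set.mem_iInter.1 h a
    exact decode_unique hg hg' ▸ h'
  · rintro ⟨g, hg, h⟩
    exact ⟨⟨g, hg, trivial⟩, Set.mem_iInter.2 fun a => ⟨g, hg, h a⟩⟩

/-- The values of the terms are introduced as existentially quantified variables. -/
theorem IsDef.subst [Finite ι] [Finite κ] {P : (κ → A) → Prop} (hP : c.IsDef P)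
    {t : κ → (ι → A) → A} (ht : ∀ k, c.IsDefFun (t k)) : c.IsDef fun g => P fun k => t k g := by
  refine IsDef.congr (IsDef.exists (κ := κ) (P := fun g h => (∀ k, t k g = h k) ∧ P h) ?_)
    fun g => ?_
  · refine IsDef.and (IsDef.forall_finite fun k => ?_) (hP.reindex Sum.inr)
    refine ((ht k).reindex (Sum.map id fun _ => k)).congr fun g => ?_
    rfl
  · constructor
    · rintro ⟨h, hh, hPh⟩
      rwa [funext hh]
    · exact fun h => ⟨_, fun _ => rfl, h⟩

variable (c) in
theorem isDef_eq : c.IsDef fun g : Fin 2 → A => g 0 = g 1 := by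
  refine definable_of_iff c.definable_eq fun p => ?_
  constructor
  · rintro ⟨a, h0, h1⟩
    exact ⟨fun _ => a, fun i => by fin_cases i <;> assumption, rfl⟩
  · rintro ⟨g, hg, h⟩
    exact ⟨g 0, hg 0, h ▸ hg 1⟩

variable (c) in
theorem isDefFun_apply [Finite ι] (i : ι) : c.IsDefFun fun g : ι → A => g i :=
  (c.isDef_eq.reindex ![Sum.inl i, Sum.inr ()]).congr fun _ => Iff.rfl

variable (c) in
theorem isDef_eq_const (a : A) : c.IsDef fun g : Unit → A => g () = a := by
  obtain ⟨q, hq⟩ := c.surjective a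
  have h1 : (Set.univ : Set M).Definable L
      {p : Unit × Fin n ⊕ Fin n → M | ∀ j, p (Sum.inr j) = q j} := by
    refine definable_of_iff (Set.definable_iInter_of_finite fun j : Fin n =>
      (Set.Definable.singleton_of_mem L (Set.mem_univ (q j))).preimage_comp
        (fun _ : Fin 1 => (Sum.inr j : Unit × Fin n ⊕ Fin n))) fun p => ?_
    simp
  have h2 := c.definable_eq.preimage_comp
    (fun i => if i.1 = 0 then Sum.inl ((), i.2) else Sum.inr i.2 : Fin 2 × Fin n → _)
  refine definable_of_iff (h1.inter h2).exists_of_finite fun p => ?_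
  constructor
  · rintro ⟨q', hq', b, h0, h1'⟩
    obtain rfl : q' = q := funext hq'
    refine ⟨fun _ => b, fun _ => h0, ?_⟩
    exact Option.some_injective _ (h1'.symm.trans hq)
  · rintro ⟨g, hg, h⟩
    exact ⟨q, fun _ => rfl, a, h ▸ hg (), hq⟩

variable (c) in
theorem isDefFun_const [Finite ι] (a : A) : c.IsDefFun fun _ : ι → A => a :=
  ((c.isDef_eq_const a).reindex fun _ => Sum.inr ()).congr fun _ => eq_comm

theorem IsDefFun.eq [Finite ι] {s t : (ι → A) → A} (hs : c.IsDefFun s) (ht : c.IsDefFun t) :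
    c.IsDef fun g => s g = t g :=
  (c.isDef_eq.subst (t := ![s, t]) (by intro k; fin_cases k <;> assumption)).congr fun _ => Iff.rfl

theorem IsDefFun.reindex [Finite ι] [Finite κ] {t : (ι → A) → A} (ht : c.IsDefFun t) (f : ι → κ) :
    c.IsDefFun fun g => t (g ∘ f) :=
  (IsDef.reindex ht (Sum.map f id)).congr fun _ => Iff.rfl

end Coding

section Group

variable {G : Type x} [Group G]

namespace Coding

variable (c : Coding L M G n)

/-- The multiplication is definable in terms of codes. -/
def IsDefGroup : Prop := c.IsDef fun g : Fin 3 → G => g 0 * g 1 = g 2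

variable {c} {ι : Type} [Finite ι]

theorem IsDefGroup.mul (hc : c.IsDefGroup) {s t : (ι → G) → G} (hs : c.IsDefFun s) (ht : c.IsDefFun t) :
    c.IsDefFun fun g => s g * t g := by
  refine (IsDef.subst hc (t := ![fun g => s (g ∘ Sum.inl), fun g => t (g ∘ Sum.inl),
    fun g => g (Sum.inr ())]) ?_).congr fun _ => Iff.rfl
  intro k
  fin_cases k
  · exact hs.reindex Sum.inl
  · exact ht.reindex Sum.inl
  · exact c.isDefFun_apply _

theorem IsDefGroup.inv (hc : c.IsDefGroup) {t : (ι → G) → G} (ht : c.IsDefFun t) :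
    c.IsDefFun fun g => (t g)⁻¹ := by
  refine ((hc.mul (ht.reindex Sum.inl) (c.isDefFun_apply (Sum.inr ()))).eq
    (c.isDefFun_const 1)).congr fun g => ?_
  exact mul_eq_one_iff_inv_eq

end Coding

/-- A group definable in `M ^ eq` has a coding with definable multiplication. -/
theorem IsDefinableGroup.exists_coding (h : IsDefinableGroup L M G) :
    ∃ (n : ℕ) (c : Coding L M G n), c.IsDefGroup := by
  classical
  obtain ⟨n, E, X, e, hX, hmul⟩ := h
  let d : (Fin n → M) → Option G := fun v =>
    if h : E.cls v ∈ X then some (e.symm ⟨E.cls v, h⟩) else none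
  have hd : ∀ v g, d v = some g ↔ E.cls v = e g := by
    intro v g
    by_cases h : E.cls v ∈ X
    · simp only [d, dif_pos h, Option.some_inj, e.symm_apply_eq, Subtype.ext_iff]
    · simp only [d, dif_neg h, reduceCtorEq, false_iff]
      exact fun h' => h (h' ▸ (e g).2)
  let c : Coding L M G n :=
    { decode := d
      surjective := fun g => by
        obtain ⟨v, hv⟩ := Quotient.exists_rep (e g : E.Points)
        exact ⟨v, (hd v g).2 hv⟩
      definable_eq := by
        refine definable_of_iff ((hX.preimage_comp fun j => ((0 : Fin 2), j)).inter
          (E.definable_rel.preimage_comp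
            (Sum.elim (fun j => ((0 : Fin 2), j)) fun j => (1, j)))) fun p => ?_
        simp only [Set.mem_ofPred_eq, hd]
        constructor
        · rintro ⟨h0, h1⟩
          refine ⟨e.symm ⟨_, h0⟩, ?_, ?_⟩
          · rw [e.apply_symm_apply]
            rfl
          · rw [e.apply_symm_apply]
            exact (Quotient.sound h1).symm
        · rintro ⟨g, h0, h1⟩
          refine ⟨?_, Quotient.exact (h0.trans h1.symm)⟩
          show E.cls (fun j => p (0, j)) ∈ X
          rw [h0]
          exact (e g).2 }
  refine ⟨n, c, definable_of_iff hmul fun p => ?_⟩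
  simp only [Set.mem_ofPred_eq, c, hd]
  constructor
  · rintro ⟨g, h, h0, h1, h2⟩
    exact ⟨![g, h, g * h], fun i => by fin_cases i <;> assumption, rfl⟩
  · rintro ⟨g, hg, h⟩
    exact ⟨g 0, g 1, hg 0, hg 1, h ▸ hg 2⟩

end Group

end Coding
end FinDim

namespace FinDim

namespace Coding

/-! ### From codings to interpretable sets -/

section Points

variable {L : FirstOrder.Language.{u, v}} {M : Type w} [L.Structure M] {A : Type x} {n : ℕ}
  (c : Coding L M A n)

/-- The equivalence relation on tuples of coding the same element, or none. -/
def defSetoid : DefSetoid L M n where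
  toSetoid := Setoid.ker c.decode
  definable_rel := by
    have h := (Set.Definable.preimage_comp Prod.snd (c.isDef_true (ι := Unit)) :
      (Set.univ : Set M).Definable L _)
    have hl := (h.preimage_comp (Sum.inl : Fin n → Fin n ⊕ Fin n)).compl
    have hr := (h.preimage_comp (Sum.inr : Fin n → Fin n ⊕ Fin n)).compl
    have he := c.definable_eq.preimage_comp
      (fun i => if i.1 = 0 then Sum.inl i.2 else Sum.inr i.2 : Fin 2 × Fin n → Fin n ⊕ Fin n)
    refine definable_of_iff (he.union (hl.inter hr)) fun p => ?_
    have key : ∀ q : Unit × Fin n → M, (∃ g : Unit → A,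
        (∀ i, c.decode (fun j => q (i, j)) = some (g i)) ∧ True) ↔
        c.decode (fun j => q ((), j)) ≠ none := by
      intro q
      rw [Option.ne_none_iff_exists']
      exact ⟨fun ⟨g, hg, _⟩ => ⟨g (), hg ()⟩, fun ⟨a, ha⟩ => ⟨fun _ => a, fun _ => ha, trivial⟩⟩
    simp only [Set.mem_union, Set.mem_inter_iff, Set.mem_compl_iff, Set.mem_preimage,
      Set.mem_ofPred_eq, key, not_not]
    show _ ∨ (c.decode (fun j => p (Sum.inl j)) = none ∧ c.decode (fun j => p (Sum.inr j)) = none) ↔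
      c.decode (fun j => p (Sum.inl j)) = c.decode (fun j => p (Sum.inr j))
    constructor
    · rintro (⟨a, h0, h1⟩ | ⟨h0, h1⟩)
      · exact Eq.trans h0 (Eq.symm h1)
      · exact h0.trans h1.symm
    · intro heq
      rcases h0 : c.decode (fun j => p (Sum.inl j)) with _ | a
      · exact Or.inr ⟨rfl, heq ▸ h0⟩
      · exact Or.inl ⟨a, h0, heq ▸ h0⟩

/-- The element coded by a class of tuples. -/
def decodePoint (q : c.defSetoid.Points) : Option A := Quotient.lift c.decode (fun _ _ h => h) q

/-- The class of the codes of `a`. -/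
noncomputable def point (a : A) : c.defSetoid.Points := c.defSetoid.cls (c.surjective a).choose

variable {c}

theorem decodePoint_point (a : A) : c.decodePoint (c.point a) = some a :=
  (c.surjective a).choose_spec

theorem cls_eq_point {p : Fin n → M} {a : A} :
    c.defSetoid.cls p = c.point a ↔ c.decode p = some a := by
  constructor
  · intro h
    exact (congrArg c.decodePoint h).trans (decodePoint_point a)
  · intro h
    exact Quotient.sound (h.trans (c.surjective a).choose_spec.symm)

theorem point_injective : Function.Injective c.point := fun a b h =>
  Option.some_injective _ (by rw [← decodePoint_point (c := c) a, h, decodePoint_point])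

theorem isInterpretable_image {S : Set A} (hS : c.IsDef fun g : Unit → A => g () ∈ S) :
    IsInterpretable c.defSetoid (c.point '' S) := by
  refine definable_of_iff (Set.Definable.preimage_comp Prod.snd hS) fun p => ?_
  constructor
  · rintro ⟨g, hg, h⟩
    exact ⟨g (), h, (cls_eq_point.2 (hg ())).symm⟩
  · rintro ⟨a, ha, h⟩
    exact ⟨fun _ => a, fun _ => cls_eq_point.1 h.symm, ha⟩

end Points

/-! ### Dimension of coded sets -/

section Dimension

variable {L : FirstOrder.Language.{u, v}} {T : L.Theory}
  {dim : ∀ (M : FirstOrder.Language.Theory.ModelType.{u, v, w} T) {n : ℕ}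
      (E : DefSetoid L M n), Set E.Points → WithBot ℕ}
  {M : FirstOrder.Language.Theory.ModelType.{u, v, w} T}
  {A B : Type x} {n k : ℕ} (c : Coding L M A n) (c' : Coding L M B k)

variable (dim) in
/-- The dimension of the set of points coding the elements of `S`. -/
noncomputable def dimSet (S : Set A) : WithBot ℕ := dim M c.defSetoid (c.point '' S)

variable {c c'}

theorem dimSet_nonneg (hdim : IsDimension.{u, v, w} T dim) {S : Set A}
    (hS : c.IsDef fun g : Unit → A => g () ∈ S) (hne : S.Nonempty) :
    0 ≤ c.dimSet dim S := by
  obtain ⟨a, ha⟩ := hne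
  have h1 := isInterpretable_image (c := c) (S := {a}) (c.isDef_eq_const a)
  have h2 : dim M c.defSetoid (c.point '' {a}) = 0 :=
    (hdim.zero_iff M _ _ h1).2 ⟨(Set.finite_singleton a).image _, (Set.singleton_nonempty a).image _⟩
  have h3 := hdim.union M _ _ _ h1 (isInterpretable_image hS)
  rw [← Set.image_union, Set.union_eq_self_of_subset_left (Set.singleton_subset_iff.2 ha), h2] at h3
  exact (le_max_left _ _).trans_eq h3.symm

theorem one_le_dimSet (hdim : IsDimension.{u, v, w} T dim) {S : Set A}
    (hS : c.IsDef fun g : Unit → A => g () ∈ S) (hinf : S.Infinite) :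
    1 ≤ c.dimSet dim S := by
  have h0 := dimSet_nonneg hdim hS hinf.nonempty
  have h1 : c.dimSet dim S ≠ 0 := fun h =>
    hinf (((hdim.zero_iff M _ _ (isInterpretable_image hS)).1 h).1.of_finite_image
      point_injective.injOn)
  generalize c.dimSet dim S = d at h0 h1
  induction d with
  | bot => simp at h0
  | coe d =>
    have : d ≠ 0 := fun h => h1 (by rw [h]; rfl)
    exact WithBot.coe_le_coe.2 (Nat.one_le_iff_ne_zero.2 this)

/-- The fibre inequality for maps with definable graph. -/
theorem dimSet_add_le (hdim : IsDimension.{u, v, w} T dim) {S : Set A} {S' : Set B}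
    (hS : c.IsDef fun g : Unit → A => g () ∈ S) (hS' : c'.IsDef fun g : Unit → B => g () ∈ S')
    {f : A → B} (hf : Set.MapsTo f S S')
    (hgraph : (Set.univ : Set M).Definable L {p : Fin n ⊕ Fin k → M |
      ∃ a ∈ S, c.decode (fun j => p (Sum.inl j)) = some a ∧
        c'.decode (fun j => p (Sum.inr j)) = some (f a)})
    {d : ℕ} (hd : ∀ b ∈ S', (d : WithBot ℕ) ≤ c.dimSet dim {a | a ∈ S ∧ f a = b}) :
    c'.dimSet dim S' + (d : WithBot ℕ) ≤ c.dimSet dim S := by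
  classical
  -- The value on the class of non-codes is arbitrary: only points over `S` enter the fibres and the
  -- graph.
  let F : c.defSetoid.Points → c'.defSetoid.Points := fun q =>
    match c.decodePoint q with
    | some a => c'.point (f a)
    | none => c'.defSetoid.cls fun _ => Classical.arbitrary M
  have hF : ∀ a, F (c.point a) = c'.point (f a) := by
    intro a
    simp only [F, decodePoint_point]
  refine hdim.le_of_fibres M c.defSetoid c'.defSetoid _ _ F d (isInterpretable_image hS)
    (isInterpretable_image hS') ⟨?_, ?_⟩ ?_
  · rintro _ ⟨a, ha, rfl⟩
    exact ⟨f a, hf ha, (hF a).symm⟩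
  · refine definable_of_iff hgraph fun p => ?_
    constructor
    · rintro ⟨a, ha, h0, h1⟩
      have h0' := cls_eq_point.2 h0
      exact ⟨⟨a, ha, h0'.symm⟩, by rw [h0', hF]; exact (cls_eq_point.2 h1).symm⟩
    · rintro ⟨⟨a, ha, h0⟩, h1⟩
      rw [← h0, hF] at h1
      exact ⟨a, ha, cls_eq_point.1 h0.symm, cls_eq_point.1 h1.symm⟩
  · rintro _ ⟨b, hb, rfl⟩
    have hb' := hd b hb
    unfold dimSet at hb'
    convert hb' using 2
    ext q
    constructor
    · rintro ⟨⟨a, ha, rfl⟩, h⟩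
      rw [hF] at h
      exact ⟨a, ⟨ha, point_injective h⟩, rfl⟩
    · rintro ⟨a, ⟨ha, rfl⟩, rfl⟩
      exact ⟨⟨a, ha, rfl⟩, hF a⟩

theorem definable_graph {S : Set A} {f : A → A}
    (h : c.IsDef fun g : Fin 2 → A => g 0 ∈ S ∧ f (g 0) = g 1) :
    (Set.univ : Set M).Definable L {p : Fin n ⊕ Fin n → M |
      ∃ a ∈ S, c.decode (fun j => p (Sum.inl j)) = some a ∧
        c.decode (fun j => p (Sum.inr j)) = some (f a)} := by
  refine definable_of_iff (h.preimage_comp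
    (fun i => if i.1 = 0 then Sum.inl i.2 else Sum.inr i.2 : Fin 2 × Fin n → Fin n ⊕ Fin n))
    fun p => ?_
  constructor
  · rintro ⟨g, hg, h0, h1⟩
    exact ⟨g 0, h0, hg 0, h1 ▸ hg 1⟩
  · rintro ⟨a, ha, h0, h1⟩
    exact ⟨![a, f a], fun i => by fin_cases i <;> assumption, ha, rfl⟩

end Dimension

/-! ### Dimension of centralisers and quotients -/

section Group

variable {L : FirstOrder.Language.{u, v}} {T : L.Theory}
  {dim : ∀ (M : FirstOrder.Language.Theory.ModelType.{u, v, w} T) {n : ℕ}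
      (E : DefSetoid L M n), Set E.Points → WithBot ℕ}
  {M : FirstOrder.Language.Theory.ModelType.{u, v, w} T}
  {G : Type x} [Group G] {n : ℕ} {c : Coding L M G n}

/-- Left translation by `g⁻¹` does not lower the dimension of `S`. -/
theorem dimSet_le_dimSet_translate (hdim : IsDimension.{u, v, w} T dim) (hc : c.IsDefGroup)
    {S S' : Set G} (hS : c.IsDef fun g : Unit → G => g () ∈ S)
    (hS' : c.IsDef fun g : Unit → G => g () ∈ S') (g : G) (h : ∀ x, x ∈ S ↔ g * x ∈ S') :
    c.dimSet dim S ≤ c.dimSet dim S' := by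
  have hfib : ∀ b ∈ S, {a | a ∈ S' ∧ g⁻¹ * a = b} = {g * b} := by
    intro b hb
    ext a
    simp only [Set.mem_ofPred_eq, Set.mem_singleton_iff, inv_mul_eq_iff_eq_mul, and_iff_right_iff_imp]
    rintro rfl
    exact (h b).1 hb
  have := dimSet_add_le hdim hS' hS (f := fun x => g⁻¹ * x) (d := 0)
    (fun x hx => (h _).2 (by simpa using hx)) (definable_graph (IsDef.and
      ((hS'.reindex fun _ => (0 : Fin 2)).congr fun _ => Iff.rfl)
      ((hc.mul (c.isDefFun_const g⁻¹) (c.isDefFun_apply 0)).eq (c.isDefFun_apply 1))))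
    (fun b hb => by
      rw [hfib b hb]
      exact dimSet_nonneg hdim (c.isDef_eq_const (g * b)) (Set.singleton_nonempty _))
  simpa using this

theorem IsDefGroup.isDef_centralizer (hc : c.IsDefGroup) (g : G) :
    c.IsDef fun y : Unit → G => y () ∈ Subgroup.centralizer {g} :=
  ((hc.mul (c.isDefFun_apply ()) (c.isDefFun_const g)).eq
    (hc.mul (c.isDefFun_const g) (c.isDefFun_apply ()))).congr fun _ =>
      Subgroup.mem_centralizer_singleton_iff.symm

/-- The dimension drops when passing to a centraliser of infinite index. -/
theorem dimSet_inf_centralizer_add_one_le (hdim : IsDimension.{u, v, w} T dim)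
    (hc : c.IsDefGroup) {H : Subgroup G} (hH : c.IsDef fun y : Unit → G => y () ∈ H) {g : G}
    (hg : ∀ k, HasOrbit k H g) :
    c.dimSet dim ((H ⊓ Subgroup.centralizer {g} : Subgroup G) : Set G) + 1 ≤
      c.dimSet dim (H : Set G) := by
  set K := H ⊓ Subgroup.centralizer {g}
  have hK : c.IsDef fun y : Unit → G => y () ∈ (K : Set G) := hH.and (hc.isDef_centralizer g)
  -- Conjugates of `g` represent the cosets of `K` in `H`: the image is infinite, hence of dimension
  -- at least one, and every fibre is a translate of `K`.
  let f : G → G := fun y => y * g * y⁻¹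
  have hfK : ∀ x y, f x = f y ↔ x⁻¹ * y ∈ Subgroup.centralizer {g} := by
    intro x y
    rw [Subgroup.mem_centralizer_singleton_iff]
    constructor
    · intro h
      calc x⁻¹ * y * g = x⁻¹ * (y * g * y⁻¹) * y := by group
        _ = x⁻¹ * (x * g * x⁻¹) * y := by rw [show y * g * y⁻¹ = x * g * x⁻¹ from h.symm]
        _ = _ := by group
    · intro h
      show x * g * x⁻¹ = y * g * y⁻¹
      calc x * g * x⁻¹ = x * (g * (x⁻¹ * y)) * y⁻¹ := by group
        _ = _ := by rw [← h]; group
  have hf : ∀ {ι : Type} [Finite ι] {t : (ι → G) → G}, c.IsDefFun t → c.IsDefFun fun y => f (t y) :=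
    fun ht => hc.mul (hc.mul ht (c.isDefFun_const g)) (hc.inv ht)
  have hS' : c.IsDef fun y : Unit → G => y () ∈ f '' H := by
    refine IsDef.exists (κ := Unit) (P := fun y h => h () ∈ H ∧ f (h ()) = y ()) ?_ |>.congr
      fun y => ⟨fun ⟨h, h1, h2⟩ => ⟨h (), h1, h2⟩, fun ⟨h, h1, h2⟩ => ⟨fun _ => h, h1, h2⟩⟩
    exact (hH.reindex fun _ => Sum.inr ()).and ((hf (c.isDefFun_apply _)).eq (c.isDefFun_apply _))
  have hinf : (f '' H).Infinite := by
    intro hfin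
    obtain ⟨y, hyH, hy⟩ := hg (hfin.toFinset.card + 1)
    have hinj : Function.Injective fun a => (⟨f (y a), y a, hyH a, rfl⟩ : f '' H) := by
      intro a b hab
      by_contra hne
      exact hy a b hne ((hfK _ _).1 (Subtype.mk.inj hab))
    have := hfin.fintype
    have h1 := Fintype.card_le_of_injective _ hinj
    rw [Fintype.card_fin, ← Set.toFinset_card, ← hfin.toFinset_eq_toFinset] at h1
    omega
  have h1 := one_le_dimSet hdim hS' hinf
  have h0 := dimSet_nonneg hdim hK ⟨1, K.one_mem⟩
  obtain ⟨d, hd⟩ : ∃ d : ℕ, c.dimSet dim (K : Set G) = d := by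
    generalize c.dimSet dim (K : Set G) = d at h0
    induction d with
    | bot => simp at h0
    | coe d => exact ⟨d, rfl⟩
  have key := dimSet_add_le hdim (S := (H : Set G)) hH hS' (f := f) (d := d)
    (fun y hy => ⟨y, hy, rfl⟩)
    (definable_graph ((hH.reindex fun _ => (0 : Fin 2)).and
      ((hf (c.isDefFun_apply 0)).eq (c.isDefFun_apply 1)))) (by
    rintro _ ⟨y, hy, rfl⟩
    rw [← hd]
    refine dimSet_le_dimSet_translate hdim hc hK
      (hH.and ((hf (c.isDefFun_apply _)).eq (c.isDefFun_const _))) y fun x => ?_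
    have h2 : f (y * x) = f y ↔ x ∈ Subgroup.centralizer {g} := by
      rw [eq_comm, hfK, inv_mul_cancel_left]
    show x ∈ H ∧ _ ↔ y * x ∈ H ∧ _
    rw [h2, H.mul_mem_cancel_left hy]
    rfl)
  rw [hd, add_comm]
  exact (add_le_add_left h1 _).trans key

/-- The coding of a quotient by a definable normal subgroup. -/
def quotient (c : Coding L M G n) (hc : c.IsDefGroup) (N : Subgroup G)
    (hN : c.IsDef fun y : Unit → G => y () ∈ N) : Coding L M (G ⧸ N) n where
  decode p := (c.decode p).map QuotientGroup.mk
  surjective q := by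
    obtain ⟨g, rfl⟩ := QuotientGroup.mk_surjective q
    obtain ⟨p, hp⟩ := c.surjective g
    exact ⟨p, by rw [hp]; rfl⟩
  definable_eq := by
    refine definable_of_iff (IsDef.subst hN (t := fun _ => fun y : Fin 2 → G => (y 0)⁻¹ * y 1)
      fun _ => hc.mul (hc.inv (c.isDefFun_apply 0)) (c.isDefFun_apply 1)) fun p => ?_
    simp only [Set.mem_ofPred_eq, Option.map_eq_some_iff]
    constructor
    · rintro ⟨y, hy, h⟩
      exact ⟨y 0, ⟨_, hy 0, rfl⟩, _, hy 1, (QuotientGroup.eq.2 h).symm⟩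
    · rintro ⟨_, ⟨a, h0, rfl⟩, b, h1, h⟩
      exact ⟨![a, b], fun i => by fin_cases i <;> assumption, QuotientGroup.eq.1 h.symm⟩

theorem isDefGroup_quotient (hc : c.IsDefGroup) (N : Subgroup G) [N.Normal]
    (hN : c.IsDef fun y : Unit → G => y () ∈ N) : (c.quotient hc N hN).IsDefGroup := by
  refine definable_of_iff (IsDef.subst hN
    (t := fun _ => fun y : Fin 3 → G => (y 0 * y 1)⁻¹ * y 2)
    fun _ => hc.mul (hc.inv (hc.mul (c.isDefFun_apply 0) (c.isDefFun_apply 1)))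
      (c.isDefFun_apply 2)) fun p => ?_
  simp only [Set.mem_ofPred_eq, quotient, Option.map_eq_some_iff]
  constructor
  · rintro ⟨y, hy, h⟩
    exact ⟨fun i => y i, fun i => ⟨y i, hy i, rfl⟩, QuotientGroup.eq.2 h⟩
  · rintro ⟨q, hq, h⟩
    choose y hy hyq using hq
    refine ⟨y, hy, QuotientGroup.eq.1 ?_⟩
    rw [QuotientGroup.mk_mul, hyq, hyq, hyq, h]

/-- The fibres of the projection are cosets of the infinite group `N`, so they have dimension at
least one. -/
theorem dimSet_quotient_add_one_le (hdim : IsDimension.{u, v, w} T dim) (hc : c.IsDefGroup)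
    (N : Subgroup G) (hN : c.IsDef fun y : Unit → G => y () ∈ N) (hinf : (N : Set G).Infinite) :
    (c.quotient hc N hN).dimSet dim Set.univ + 1 ≤ c.dimSet dim Set.univ := by
  refine dimSet_add_le hdim (c.isDef_true) ((c.quotient hc N hN).isDef_true)
    (S := Set.univ) (S' := Set.univ) (f := QuotientGroup.mk) (d := 1)
    (fun _ _ => Set.mem_univ _) ?_ ?_
  · refine definable_of_iff (Set.Definable.preimage_comp
      (fun i => if i.1 = 0 then Sum.inl i.2 else Sum.inr i.2 : Fin 2 × Fin n → Fin n ⊕ Fin n)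
      (IsDef.subst hN (t := fun _ => fun y : Fin 2 → G => (y 0)⁻¹ * y 1)
      fun _ => hc.mul (hc.inv (c.isDefFun_apply 0)) (c.isDefFun_apply 1))) fun p => ?_
    simp only [Set.mem_ofPred_eq, quotient, Option.map_eq_some_iff]
    constructor
    · rintro ⟨y, hy, h⟩
      exact ⟨y 0, trivial, hy 0, _, hy 1, (QuotientGroup.eq.2 h).symm⟩
    · rintro ⟨a, -, h0, b, h1, h⟩
      exact ⟨![a, b], fun i => by fin_cases i <;> assumption, QuotientGroup.eq.1 h.symm⟩
  · intro q _
    obtain ⟨y, rfl⟩ := QuotientGroup.mk_surjective q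
    have heq : {a : G | a ∈ Set.univ ∧ (a : G ⧸ N) = y} = {a | y⁻¹ * a ∈ N} := by
      ext a
      simp only [Set.mem_univ, true_and, Set.mem_ofPred_eq]
      rw [eq_comm, QuotientGroup.eq]
    rw [heq]
    refine one_le_dimSet hdim (IsDef.subst hN (t := fun _ => fun a : Unit → G => y⁻¹ * a ())
      fun _ => hc.mul (c.isDefFun_const _) (c.isDefFun_apply ())) ?_
    have : {a | y⁻¹ * a ∈ N} = (fun a => y * a) '' (N : Set G) := by
      ext a
      exact ⟨fun h => ⟨_, h, by simp⟩, by rintro ⟨b, hb, rfl⟩; simpa using hb⟩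
    rw [this]
    exact hinf.image (mul_right_injective y).injOn

theorem IsDefGroup.isDef_almostCentre (hc : c.IsDefGroup) {m : ℕ}
    (hm : ∀ g, g ∈ almostCentre G ↔ ¬ HasOrbit m ⊤ g) :
    c.IsDef fun g : Unit → G => g () ∈ almostCentre G := by
  have h : c.IsDef fun g : Unit → G => ∃ y : Fin m → G, ∀ p : {p : Fin m × Fin m // p.1 ≠ p.2},
      ¬ ((y p.1.1)⁻¹ * y p.1.2 * g () = g () * ((y p.1.1)⁻¹ * y p.1.2)) := by
    refine IsDef.exists (IsDef.forall_finite fun p => IsDef.not (IsDefFun.eq ?_ ?_))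
    · exact hc.mul (hc.mul (hc.inv (c.isDefFun_apply _)) (c.isDefFun_apply _)) (c.isDefFun_apply _)
    · exact hc.mul (c.isDefFun_apply _) (hc.mul (hc.inv (c.isDefFun_apply _)) (c.isDefFun_apply _))
  refine h.not.congr fun g => (not_congr ?_).trans (hm (g ())).symm
  refine exists_congr fun y => ⟨fun h => ⟨fun _ => Subgroup.mem_top _, fun a b hab hc => ?_⟩, fun h p hc => ?_⟩
  · exact h ⟨(a, b), hab⟩ (Subgroup.mem_centralizer_singleton_iff.1 hc)
  · exact h.2 _ _ p.2 (Subgroup.mem_centralizer_singleton_iff.2 hc)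

end Group

end Coding

end FinDim

namespace FinDim

open Filter

/-! ### Ultrapowers of coded groups -/

section Ultrapower

variable {L : FirstOrder.Language.{u, v}} {M : Type w} (U : Ultrafilter ℕ)

/-- The ultrapower of `M`. -/
abbrev Ultrapower (M : Type w) (U : Ultrafilter ℕ) : Type w := (U : Filter ℕ).Product fun _ => M

/-- The class of a sequence in the ultrapower. -/
def Ultrapower.mk (x : ℕ → M) : Ultrapower M U := Quotient.mk _ x

variable [L.Structure M]

/-- The ultrapower of a definable set is definable. -/
theorem definable_ultrapower [Nonempty M] {α : Type*} {s : Set (α → M)}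
    (hs : (Set.univ : Set M).Definable L s) :
    ∃ t : Set (α → Ultrapower M U), (Set.univ : Set (Ultrapower M U)).Definable L t ∧
      ∀ p : α → ℕ → M, (fun i => Ultrapower.mk U (p i)) ∈ t ↔
        ∀ᶠ k in (U : Filter ℕ), (fun i => p i k) ∈ s := by
  obtain ⟨φ, rfl⟩ := Set.definable_iff_exists_formula_sum.1 hs
  -- Parameters become constant sequences, after which Łoś's theorem applies.
  let ψ : L.Formula ((Set.univ : Set (Ultrapower M U)) ⊕ α) :=
    φ.relabel (Sum.map (fun a => ⟨Ultrapower.mk U fun _ => a.1, trivial⟩) id)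
  refine ⟨_, Set.definable_iff_exists_formula_sum.2 ⟨ψ, rfl⟩, fun p => ?_⟩
  have h := FirstOrder.Language.Ultraproduct.realize_formula_cast (u := U) φ
    (Sum.elim (fun a _ => a.1) p)
  refine FirstOrder.Language.Formula.realize_relabel.trans ((iff_of_eq (congrArg _ ?_)).trans (h.trans (eventually_congr (Eventually.of_forall
    fun k => iff_of_eq (congrArg _ ?_)))))
  · funext i
    rcases i with i | i <;> rfl
  · funext i
    rcases i with i | i <;> rfl

namespace Coding

variable {A : Type x} {n : ℕ} (c : Coding L M A n)

open Classical in
/-- Decoding of tuples of sequences, up to the ultrafilter. -/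
noncomputable def decodeGerm (p : Fin n → Ultrapower M U) : Option (Germ (U : Filter ℕ) A) :=
  if h : ∃ f : ℕ → A, ∀ᶠ k in (U : Filter ℕ), c.decode (fun j => (p j).out k) = some (f k) then
    some (h.choose : Germ (U : Filter ℕ) A)
  else none

theorem decodeGerm_eq_some_iff {x : Fin n → ℕ → M} {f : ℕ → A} :
    c.decodeGerm U (fun j => Ultrapower.mk U (x j)) =
        some (f : Germ (U : Filter ℕ) A) ↔
      ∀ᶠ k in (U : Filter ℕ), c.decode (fun j => x j k) = some (f k) := by
  set p : Fin n → Ultrapower M U := fun j => Ultrapower.mk U (x j)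
  have hout : ∀ᶠ k in (U : Filter ℕ), ∀ j, (p j).out k = x j k :=
    eventually_all.2 fun j => Quotient.exact (p j).out_eq
  have hiff : ∀ f : ℕ → A,
      (∀ᶠ k in (U : Filter ℕ), c.decode (fun j => (p j).out k) = some (f k)) ↔
      ∀ᶠ k in (U : Filter ℕ), c.decode (fun j => x j k) = some (f k) := by
    intro f
    refine eventually_congr (hout.mono fun k hk => ?_)
    rw [funext hk]
  rw [← hiff]
  unfold decodeGerm
  split_ifs with h
  · rw [Option.some_inj, Germ.coe_eq]
    have hs := h.choose_spec
    constructor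
    · intro heq
      filter_upwards [hs, heq] with k h1 h2
      rw [h1, h2]
    · intro hf
      filter_upwards [hs, hf] with k h1 h2
      exact Option.some_injective _ (h1.symm.trans h2)
  · simp only [false_iff]
    exact fun hf => h ⟨f, hf⟩

/-- The hypothesis `h` says that `Q` is the ultrapower of `P`; for equality and multiplication it is
just equality of germs. -/
theorem definable_decodeGerm [Nonempty M] {ι : Type} [Finite ι] {P : (ι → A) → Prop} (hP : c.IsDef P)
    {Q : (ι → Germ (U : Filter ℕ) A) → Prop}
    (h : ∀ f : ι → ℕ → A, Q (fun i => (f i : Germ (U : Filter ℕ) A)) ↔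
      ∀ᶠ k in (U : Filter ℕ), P fun i => f i k) :
    (Set.univ : Set (Ultrapower M U)).Definable L {p : ι × Fin n → Ultrapower M U |
      ∃ g, (∀ i, c.decodeGerm U (fun j => p (i, j)) = some (g i)) ∧ Q g} := by
  obtain ⟨t, ht, htm⟩ := definable_ultrapower U hP
  refine definable_of_iff ht fun p => ?_
  obtain ⟨x, rfl⟩ : ∃ x : ι × Fin n → ℕ → M,
      p = fun i => Ultrapower.mk U (x i) :=
    ⟨fun i => (p i).out, funext fun i => (Quotient.out_eq (p i)).symm⟩
  rw [htm]
  constructor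
  · intro hx
    obtain ⟨f, hf⟩ := hx.choice
    refine ⟨fun i => ((fun k => f k i : ℕ → A) : Germ (U : Filter ℕ) A), fun i => ?_, ?_⟩
    · rw [decodeGerm_eq_some_iff]
      exact hf.mono fun k hk => hk.1 i
    · rw [h]
      exact hf.mono fun k hk => hk.2
  · rintro ⟨g, hg, hQ⟩
    obtain ⟨f, rfl⟩ : ∃ f : ι → ℕ → A, g = fun i => (f i : Germ (U : Filter ℕ) A) :=
      ⟨fun i => (g i).out, funext fun i => (Quotient.out_eq (g i)).symm⟩
    have h1 : ∀ᶠ k in (U : Filter ℕ), ∀ i, c.decode (fun j => x (i, j) k) = some (f i k) :=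
      eventually_all.2 fun i => (c.decodeGerm_eq_some_iff U).1 (hg i)
    filter_upwards [h1, (h f).1 hQ] with k hk hPk
    exact ⟨_, hk, hPk⟩

/-- The coding of an ultrapower. -/
noncomputable def ultrapower [Nonempty M] : Coding L (Ultrapower M U) (Germ (U : Filter ℕ) A) n where
  decode := c.decodeGerm U
  surjective a := by
    induction a using Germ.inductionOn with | _ f
    choose x hx using fun k => c.surjective (f k)
    exact ⟨_, (c.decodeGerm_eq_some_iff U (x := fun j k => x k j)).2 (Eventually.of_forall hx)⟩
  definable_eq := by
    refine definable_of_iff (c.definable_decodeGerm U c.isDef_eq (Q := fun g => g 0 = g 1)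
      fun f => Germ.coe_eq) fun p => ?_
    constructor
    · rintro ⟨g, hg, h⟩
      exact ⟨g 0, hg 0, h ▸ hg 1⟩
    · rintro ⟨a, h0, h1⟩
      exact ⟨fun _ => a, fun i => by fin_cases i <;> assumption, rfl⟩

theorem isDefGroup_ultrapower [Nonempty M] {G : Type x} [Group G] {c : Coding L M G n} (hc : c.IsDefGroup) :
    (c.ultrapower U).IsDefGroup :=
  c.definable_decodeGerm U hc (Q := fun g => g 0 * g 1 = g 2) fun _ => Germ.coe_eq

end Coding

end Ultrapower

/-! ### An infinite chain in the ultrapower -/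

section Group

variable {G : Type x} [Group G]

theorem HasOrbit.mono {k k' : ℕ} {H H' : Subgroup G} {g : G} (h : HasOrbit k H g) (hk : k' ≤ k)
    (hH : H ≤ H') : HasOrbit k' H' g := by
  obtain ⟨y, hy, hyy⟩ := h
  exact ⟨fun a => y (Fin.castLE hk a), fun a => hH (hy _),
    fun a b hab => hyy _ _ (by simpa [Fin.ext_iff] using hab)⟩

/-- A chain of centralisers as a sequence of elements. -/
theorem HasChain.exists_seq {k : ℕ} {r : ℕ} {H : Subgroup G} (h : HasChain k r H) :
    ∃ g : ℕ → G, ∀ i < r, HasOrbit k (H ⊓ ⨅ j : Fin i, Subgroup.centralizer {g j}) (g i) := by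
  induction r generalizing H with
  | zero => exact ⟨fun _ => 1, fun i hi => absurd hi (Nat.not_lt_zero i)⟩
  | succ r ih =>
    obtain ⟨x, hx, h⟩ := h
    obtain ⟨g, hg⟩ := ih h
    refine ⟨fun i => Nat.casesOn i x g, fun i hi => ?_⟩
    cases i with
    | zero => exact hx.mono le_rfl (le_inf le_rfl (le_iInf fun j => j.elim0))
    | succ i =>
      refine (hg i (Nat.lt_of_succ_lt_succ hi)).mono le_rfl ?_
      rw [inf_assoc]
      refine inf_le_inf_left _ (le_iInf fun j => ?_)
      cases j using Fin.cases with
      | zero => exact inf_le_left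
      | succ j => exact inf_le_right.trans (iInf_le _ j)

/-- If the chain condition fails, an ultrapower has an infinite chain of centralisers each of
infinite index in the preceding one. -/
theorem exists_germ_chain {U : Ultrafilter ℕ} (hU : (U : Filter ℕ) ≤ atTop)
    (h : ¬ ChainBounded G) :
    ∃ g : ℕ → Germ (U : Filter ℕ) G, ∀ i k,
      HasOrbit k (⨅ j : Fin i, Subgroup.centralizer {g j}) (g i) := by
  have h' : ∀ r, HasChain r r (⊤ : Subgroup G) := by simpa [ChainBounded] using h
  choose g hg using fun r => (h' r).exists_seq
  simp only [top_inf_eq] at hg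
  refine ⟨fun i => ((fun r => g r i : ℕ → G) : Germ (U : Filter ℕ) G), fun i k => ?_⟩
  have hev : ∀ᶠ r in (U : Filter ℕ), ∃ y : Fin k → G,
      (∀ a, y a ∈ ⨅ j : Fin i, Subgroup.centralizer {g r j}) ∧
        ∀ a b, a ≠ b → (y a)⁻¹ * y b ∉ Subgroup.centralizer {g r i} := by
    -- A chain of length and width `r` has an `i`-th step, with at least `k` cosets, once `r ≥ max
    -- (i + 1) k`; this holds for almost all `r`.
    filter_upwards [hU (eventually_ge_atTop (max (i + 1) k))] with r hr
    exact (hg r i (lt_of_lt_of_le (Nat.lt_succ_self i) (le_of_max_le_left hr))).mono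
      (le_of_max_le_right hr) le_rfl
  obtain ⟨y, hy⟩ := hev.choice
  have hmem : ∀ s t : ℕ → G, (s : Germ (U : Filter ℕ) G) ∈
      Subgroup.centralizer {(t : Germ (U : Filter ℕ) G)} ↔
      ∀ᶠ r in (U : Filter ℕ), s r ∈ Subgroup.centralizer {t r} := by
    intro s t
    simp only [Subgroup.mem_centralizer_singleton_iff]
    exact Germ.coe_eq
  refine ⟨fun a => ((fun r => y r a : ℕ → G) : Germ (U : Filter ℕ) G), fun a => ?_,
    fun a b hab hc => ?_⟩
  · refine Subgroup.mem_iInf.2 fun j => (hmem _ _).2 (hy.mono fun r hr => ?_)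
    exact Subgroup.mem_iInf.1 (hr.1 a) j
  · obtain ⟨r, hr, hr'⟩ := (((hmem (fun r => (y r a)⁻¹ * y r b) _).1 hc).and hy).exists
    exact hr'.2 a b hab hr

end Group

/-! ### The chain condition and the induction on dimension -/

namespace Coding

variable {L : FirstOrder.Language.{u, v}} {T : L.Theory}
  {dim : ∀ (M : FirstOrder.Language.Theory.ModelType.{u, v, w} T) {n : ℕ}
      (E : DefSetoid L M n), Set E.Points → WithBot ℕ}
  {M : FirstOrder.Language.Theory.ModelType.{u, v, w} T}
  {G : Type x} [Group G] {n : ℕ} {c : Coding L M G n}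

theorem not_infinite_chain (hdim : IsDimension.{u, v, w} T dim) (hc : c.IsDefGroup) (g : ℕ → G)
    (h : ∀ i k, HasOrbit k (⨅ j : Fin i, Subgroup.centralizer {g j}) (g i)) : False := by
  have hdef : ∀ i, c.IsDef fun y : Unit → G =>
      y () ∈ ⨅ j : Fin i, Subgroup.centralizer {g j} := fun i =>
    (IsDef.forall_finite fun j : Fin i => hc.isDef_centralizer (g j)).congr
      fun _ => Subgroup.mem_iInf.symm
  have hstep : ∀ i, c.dimSet dim ((⨅ j : Fin (i + 1), Subgroup.centralizer {g j} : Subgroup G) :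
      Set G) + 1 ≤ c.dimSet dim ((⨅ j : Fin i, Subgroup.centralizer {g j} : Subgroup G) : Set G) := by
    intro i
    have heq : (⨅ j : Fin (i + 1), Subgroup.centralizer {g j} : Subgroup G) =
        (⨅ j : Fin i, Subgroup.centralizer {g j}) ⊓ Subgroup.centralizer {g i} := by
      ext y
      simp only [Subgroup.mem_iInf, Subgroup.mem_inf]
      exact Fin.forall_fin_succ'
    rw [heq]
    exact dimSet_inf_centralizer_add_one_le hdim hc (hdef i) (h i)
  have hnat : ∀ i, ∃ d : ℕ, c.dimSet dim
      ((⨅ j : Fin i, Subgroup.centralizer {g j} : Subgroup G) : Set G) = d := by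
    intro i
    have := dimSet_nonneg hdim (c := c) (hdef i)
      (S := ((⨅ j : Fin i, Subgroup.centralizer {g j} : Subgroup G) : Set G)) ⟨1, one_mem _⟩
    obtain ⟨d, hd, -⟩ := WithBot.coe_le_iff.1 this
    exact ⟨d, hd⟩
  choose d hd using hnat
  have hlt : ∀ i, d (i + 1) < d i := by
    intro i
    have := hstep i
    rw [hd, hd] at this
    exact Nat.lt_of_succ_le (WithBot.coe_le_coe.1 this)
  have hbound : ∀ i, d i + i ≤ d 0 := by
    intro i
    induction i with
    | zero => exact le_rfl
    | succ i ih => have := hlt i; omega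
  have := hbound (d 0 + 1)
  omega

theorem chainBounded (hdim : IsDimension.{u, v, w} T dim) (hc : c.IsDefGroup) :
    ChainBounded G := by
  by_contra h
  let U : Ultrafilter ℕ := hyperfilter ℕ
  obtain ⟨g, hg⟩ := exists_germ_chain (U := U) Nat.hyperfilter_le_atTop h
  have hT : (Ultrapower M U) ⊨ T := by
    refine ⟨fun φ hφ => ?_⟩
    rw [FirstOrder.Language.Ultraproduct.sentence_realize]
    exact Eventually.of_forall fun _ => T.realize_sentence_of_mem hφ
  exact not_infinite_chain (M := FirstOrder.Language.Theory.ModelType.of T (Ultrapower M U)) hdim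
    (isDefGroup_ultrapower U hc) g hg

/-- Induction on dimension: the quotient by the infinite definable almost centre is again locally
nilpotent and is coded by tuples from the same model, with smaller dimension. -/
theorem almostNilpotent_and_virtuallyNilpotent (hdim : IsDimension.{u, v, w} T dim)
    (hc : c.IsDefGroup) (hnil : IsLocallyNilpotent G) :
    IsAlmostNilpotent G ∧ Group.IsVirtuallyNilpotent G := by
  obtain ⟨d, hd⟩ : ∃ d : ℕ, c.dimSet dim Set.univ ≤ d := by
    rcases hd : c.dimSet dim Set.univ with _ | d
    · exact ⟨0, bot_le⟩
    · exact ⟨d, le_rfl⟩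
  induction d using Nat.strong_induction_on generalizing G with | _ d ih
  rcases finite_or_infinite G with hfin | hinf
  · exact ⟨isAlmostNilpotent_of_finite, isVirtuallyNilpotent_of_finite⟩
  have hcb := chainBounded hdim hc
  have hZ : (almostCentre G : Set G).Infinite := fun hZ =>
    not_finite_iff_infinite.2 hinf (finite_of_finite_almostCentre hnil hcb hZ)
  obtain ⟨m, hm⟩ := exists_mem_almostCentre_iff hcb
  have hdef := hc.isDef_almostCentre hm
  have hle := dimSet_quotient_add_one_le hdim hc _ hdef hZ
  have hc' := isDefGroup_quotient hc _ hdef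
  have h0 : 0 ≤ (c.quotient hc _ hdef).dimSet dim Set.univ :=
    dimSet_nonneg hdim (isDef_true _) ⟨1, trivial⟩
  obtain ⟨e, he, -⟩ := WithBot.coe_le_iff.1 h0
  have hlt : e < d := by
    rw [he] at hle
    exact Nat.lt_of_succ_le (WithBot.coe_le_coe.1 (hle.trans hd))
  obtain ⟨h1, h2⟩ := ih e hlt hc' (hnil.of_surjective (QuotientGroup.mk' _)
    (QuotientGroup.mk'_surjective _)) he.le
  exact ⟨isAlmostNilpotent_of_quotient_almostCentre h1,
    isVirtuallyNilpotent_of_quotient_almostCentre (fun g hg => (hm g).1 hg) h2⟩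

end Coding

end FinDim

theorem mainTheorem9 {L : FirstOrder.Language.{u, v}} (T : L.Theory)
    (hT : FinDim.IsFiniteDimensional.{u, v, max u v w} T)
    (M : FirstOrder.Language.Theory.ModelType.{u, v, max u v w} T)
    (G : Type x) [Group G] (hG : FinDim.IsDefinableGroup L M G)
    (hnil : FinDim.IsLocallyNilpotent G) :
    (Infinite G → Infinite (FinDim.almostCentre G)) ∧
      FinDim.IsAlmostNilpotent G ∧
      Group.IsVirtuallyNilpotent G := by
  obtain ⟨dim, hdim⟩ := hT
  obtain ⟨n, c, hc⟩ := hG.exists_coding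
  refine ⟨fun hinf => ?_, FinDim.Coding.almostNilpotent_and_virtuallyNilpotent hdim hc hnil⟩
  by_contra hZ
  rw [not_infinite_iff_finite] at hZ
  exact not_finite_iff_infinite.2 hinf
    (FinDim.finite_of_finite_almostCentre hnil (FinDim.Coding.chainBounded hdim hc) hZ)
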